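/- Let $n\ge 2$ and $[n]=\{1,\dots,n\}$. Let $\mathcal F_n$ be the set of all functions $f:\{2,\dots,n-1\}\to[n]$; the digraph of $f$ has vertex set $[n]$ and edges $\langle i,f(i)\rangle$ for $2\le i\le n-1$. Let $\vec C_{n,1}$ be the set of directed trees on $[n]$ rooted at $1$, with all edges directed towards the root. For $f\in\mathcal F_n$ let $m_1>m_2>\dots>m_a$ be the largest elements of the directed cycles (loops included) of the digraph of $f$, and let $l_i=f(m_i)$. The digraph $\Theta(f)$ is obtained from the digraph of $f$ by deleting the edges $\langle m_i,l_i\rangle$ for $1\le i\le a$ and adding the edges $\langle n,l_1\rangle$, $\langle m_i,l_{i+1}\rangle$ for $1\le i<a$, and $\langle m_a,1\rangle$; if $a=0$, only the edge $\langle n,1\rangle$ is added. **Theorem.** For every $n\ge 2$, $\Theta$ is a bijection $\mathcal F_n\to\vec C_{n,1}$, and both $\Theta$ and $\Theta^{-1}$ can be computed in time linear in $n$. Precisely, there are a constant $C$ and two fixed programs for a random access machine (with finitely many registers and arrays, and with assignment of constants, copying, addition, truncated subtraction, indirect reading and writing, and comparisons, each at unit cost) such that for all $n\ge2$: 1. for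 every $f\in\mathcal F_n$, the first program, given $n$ and the edges $\langle i,f(i)\rangle$ of the digraph of $f$ as a list of pairs in any order, halts after at most $Cn$ steps and outputs the list of the edges $\langle i,t_i\rangle$ of $\Theta(f)$ in order of increasing $i$; 2. for every $T\in\vec C_{n,1}$, the second program, given $n$ and the edges $\langle i,t_i\rangle$ of $T$ as a list of pairs in any order, halts after at most $Cn$ steps and outputs the list of the edges $\langle i,f(i)\rangle$, $i=2,\dots,n-1$, where $f=\Theta^{-1}(T)$. All numbers that occur during these computations are at most $Cn$, so that machine words of $O(\log n)$ bits suffice. -/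

import Mathlib

namespace Cayley

/-- The vertex set `[n] = {1, …, n}`. -/
abbrev Vertex (n : ℕ) : Type := Set.Icc 1 n

/-- The domain `{2, …, n - 1}`. -/
abbrev Inner (n : ℕ) : Type := Set.Ioo 1 n

/-- The set `F_n` of all functions `{2, …, n - 1} → [n]`. -/
abbrev Fn (n : ℕ) : Type := Inner n → Vertex n

/-- The digraph of `f` on `[n]`, with the edges `⟨i, f i⟩`, `2 ≤ i ≤ n - 1`. -/
def graph {n : ℕ} (f : Fn n) : Digraph (Vertex n) where
  Adj i j := ∃ k : Inner n, (k : ℕ) = i ∧ f k = j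

/-- `G` is a directed tree rooted at `r` with all edges directed towards `r`: no edge leaves `r`,
exactly one edge leaves every other vertex, and every vertex has a directed path to `r`. -/
structure IsRootedTree {V : Type*} (G : Digraph V) (r : V) : Prop where
  root_out : ∀ v, ¬ G.Adj r v
  out_unique : ∀ v, v ≠ r → ∃! w, G.Adj v w
  path_to_root : ∀ v, Relation.ReflTransGen G.Adj v r

/-- The set of directed trees on `[n]` that are rooted at `1`. -/
def Trees (n : ℕ) : Set (Digraph (Vertex n)) :=
  {T | ∃ r : Vertex n, (r : ℕ) = 1 ∧ IsRootedTree T r}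

/-- There is a directed path with at least one edge from `u` to `v` in the digraph of `f`. -/
def Reaches {n : ℕ} (f : Fn n) (u v : Vertex n) : Prop :=
  Relation.TransGen (graph f).Adj u v

/-- `m` lies on a directed cycle of the digraph of `f` (possibly a loop) and is the largest vertex
of that cycle; the cycle of `m` consists of the vertices `v` such that `m` reaches `v` and `v`
reaches `m`. -/
def IsCycleMax {n : ℕ} (f : Fn n) (m : Inner n) : Prop :=
  ∃ u : Vertex n, (u : ℕ) = m ∧ Reaches f u u ∧ ∀ v, Reaches f u v → Reaches f v u → v ≤ u

open Classical in
/-- The maxima `m_1 > ⋯ > m_a` of the cycles of `f`, in decreasing order.  The cycle of `m_i` is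
drawn as a path from `l_i = f m_i` on its left to `m_i` on its right, with back edge
`⟨m_i, l_i⟩`. -/
noncomputable def cycleMaxima {n : ℕ} (f : Fn n) : List (Inner n) :=
  (Finset.univ.filter (IsCycleMax f)).sort (· ≥ ·)

/-- The edges `⟨n, l_1⟩, ⟨m_1, l_2⟩, …, ⟨m_{a-1}, l_a⟩, ⟨m_a, 1⟩`, or just `⟨n, 1⟩` when `f` has no
cycle. -/
noncomputable def newEdges {n : ℕ} (f : Fn n) : List (ℕ × ℕ) :=
  List.zip (n :: (cycleMaxima f).map (fun m => (m : ℕ)))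
    ((cycleMaxima f).map (fun m => (f m : ℕ)) ++ [1])

/-- `Θ(f)`: the digraph of `f` with the back edges `⟨m_i, l_i⟩` removed and the new edges added. -/
noncomputable def theta {n : ℕ} (f : Fn n) : Digraph (Vertex n) where
  Adj i j :=
    ((graph f).Adj i j ∧ ¬ ∃ m ∈ cycleMaxima f, (m : ℕ) = i ∧ f m = j) ∨
      ((i : ℕ), (j : ℕ)) ∈ newEdges f

/-- `L` lists every edge of `G` exactly once, in any order. -/
def IsEdgeList {n : ℕ} (G : Digraph (Vertex n)) (L : List (Vertex n × Vertex n)) : Prop :=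
  L.Nodup ∧ ∀ i j, (i, j) ∈ L ↔ G.Adj i j

/-- `L` lists the edges of `G` by increasing source vertex. -/
def IsTable {n : ℕ} (G : Digraph (Vertex n)) (L : List (Vertex n × Vertex n)) : Prop :=
  IsEdgeList G L ∧ L.Pairwise (fun e e' => e.1 < e'.1)

end Cayley

/-! Random access machine: a fixed finite program acts on registers and arrays that hold natural
numbers bounded by a word bound `W`; every operation, memory access and test takes one step.
A program mentions only finitely many registers and arrays. -/
namespace RAM

/-- Contents of the memory: `reg x` is register number `x`, and `arr a k` is the cell with
address `k` in array number `a`. -/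
structure State where
  reg : ℕ → ℕ
  arr : ℕ → ℕ → ℕ

/-- Right-hand sides of assignments. -/
inductive Op where
  | const (k : ℕ)
  | copy (y : ℕ)
  | add (y z : ℕ)
  | sub (y z : ℕ)
  | load (a y : ℕ)

/-- Value of a right-hand side; subtraction is truncated at `0`, and `load a y` reads array `a` at
the address held in register `y`. -/
def Op.eval (s : State) : Op → ℕ
  | .const k => k
  | .copy y => s.reg y
  | .add y z => s.reg y + s.reg z
  | .sub y z => s.reg y - s.reg z
  | .load a y => s.arr a (s.reg y)

/-- Comparisons of two registers. -/
inductive Test where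
  | eq (x y : ℕ)
  | ne (x y : ℕ)
  | lt (x y : ℕ)
  | le (x y : ℕ)

def Test.Holds (s : State) : Test → Prop
  | .eq x y => s.reg x = s.reg y
  | .ne x y => s.reg x ≠ s.reg y
  | .lt x y => s.reg x < s.reg y
  | .le x y => s.reg x ≤ s.reg y

/-- Programs. `assign x o` puts the value of `o` into register `x`; `store a x y` puts the content
of register `y` into the cell of array `a` whose address is held in register `x`. -/
inductive Program where
  | skip
  | assign (x : ℕ) (o : Op)
  | store (a x y : ℕ)
  | seq (p q : Program)
  | ite (b : Test) (p q : Program)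
  | while (b : Test) (p : Program)

def State.setReg (s : State) (x v : ℕ) : State :=
  { s with reg := Function.update s.reg x v }

def State.setArr (s : State) (a k v : ℕ) : State :=
  { s with arr := Function.update s.arr a (Function.update (s.arr a) k v) }

/-- `Exec W p s t s'`: started in `s`, the program `p` halts in `s'` after exactly `t` steps, and
no assignment produces a number greater than `W`. -/
inductive Exec (W : ℕ) : Program → State → ℕ → State → Prop where
  | skip (s : State) : Exec W .skip s 1 s
  | assign (s : State) (x : ℕ) (o : Op) (h : o.eval s ≤ W) :
      Exec W (.assign x o) s 1 (s.setReg x (o.eval s))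
  | store (s : State) (a x y : ℕ) :
      Exec W (.store a x y) s 1 (s.setArr a (s.reg x) (s.reg y))
  | seq {p q : Program} {s s' s'' : State} {t t' : ℕ}
      (hp : Exec W p s t s') (hq : Exec W q s' t' s'') :
      Exec W (.seq p q) s (t + t') s''
  | ite_true {b : Test} {p q : Program} {s s' : State} {t : ℕ}
      (hb : b.Holds s) (hp : Exec W p s t s') : Exec W (.ite b p q) s (t + 1) s'
  | ite_false {b : Test} {p q : Program} {s s' : State} {t : ℕ}
      (hb : ¬ b.Holds s) (hq : Exec W q s t s') : Exec W (.ite b p q) s (t + 1) s'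
  | while_true {b : Test} {p : Program} {s s' s'' : State} {t t' : ℕ}
      (hb : b.Holds s) (hp : Exec W p s t s') (hw : Exec W (.while b p) s' t' s'') :
      Exec W (.while b p) s (t + t' + 1) s''
  | while_false {b : Test} {p : Program} {s : State}
      (hb : ¬ b.Holds s) : Exec W (.while b p) s 1 s

/-- The input state: register `0` holds `n`, the pair number `k` of `L` is in the cells with
address `k` of the arrays `0` and `1`, and everything else is `0`. -/
def input (n : ℕ) (L : List (Cayley.Vertex n × Cayley.Vertex n)) : State where
  reg x := if x = 0 then n else 0
  arr a k :=
    match a with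
    | 0 => (L[k]?.map fun e => (e.1 : ℕ)).getD 0
    | 1 => (L[k]?.map fun e => (e.2 : ℕ)).getD 0
    | _ => 0

/-- The state holds `n` and the list `L` in the places where `input` puts them. -/
def State.Stores (s : State) (n : ℕ) (L : List (Cayley.Vertex n × Cayley.Vertex n)) : Prop :=
  s.reg 0 = n ∧
    ∀ (k : ℕ) (h : k < L.length), s.arr 0 k = (L[k].1 : ℕ) ∧ s.arr 1 k = (L[k].2 : ℕ)

/-- On input `n` and the list `L`, the program `p` halts after at most `t` steps, without producing
a number greater than `W`, and its output is the list of edges `⟨i, j⟩` of `G` by increasing `i`. -/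
def Outputs (p : Program) (W t n : ℕ) (L : List (Cayley.Vertex n × Cayley.Vertex n))
    (G : Digraph (Cayley.Vertex n)) : Prop :=
  ∃ t' ≤ t, ∃ s : State, Exec W p (input n L) t' s ∧
    ∃ L', Cayley.IsTable G L' ∧ s.Stores n L'

end RAM

/-! A digraph with at most one edge out of each vertex is encoded as a map `G : ℕ → ℕ`, with value
`0` where no edge leaves. Adding the edge ⟨n, 1⟩ to `f` gives a map with a path from `n` to the root
`1`; no vertex on that path is cyclic, and all cycles lie below `n`.

Then Θ is an iteration of one local step on pairs (G, p), where `p` is the predecessor of `1` on the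
path from `n`. Let `m` be the greatest cyclic vertex. The map `splice G p m` lets `p` inherit the
edge of `m` and sends `m` to `1`, so the cycle of `m` becomes the end of the path and `m` the new
predecessor of `1`. The other cycles are untouched (`Merge.cyc_splice`). When no cycle is left,
pigeonhole gives every vertex a path to `1`, so the result is a tree.

The step is reversible because all vertices behind `p` on the new path are at most `m`, while `m <
p`: thus `p` is the last path vertex larger than `m` (`Merge.injective`). The end of the path
strictly decreases, so a chain of steps that begins at `p = n` cannot be prolonged backwards. This
gives injectivity. For surjectivity, the path of a tree from `n` to `1` is walked backwards; each
vertex that exceeds all path vertices behind it undoes one step (`Linked.unmerge`). The vertex `n`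
exceeds every other path vertex, so the walk ends with `p = n`.

Both algorithms follow this description. For Θ, repeatedly removing vertices without incoming edges
leaves exactly the cyclic ones (`PeelInv`); a downward scan then recognises a cycle maximum as the
first vertex of its cycle that is met (`ScanInv`). The inverse is the backward walk (`BackInv`), and
its correctness proof also supplies surjectivity. Every loop has a loop-free body and a linearly
bounded measure that drops in each round. -/

namespace RAM

/-! ### Time-bounded correctness of programs -/

/-- Started in `s`, the program halts within `c` steps in a state that satisfies `Q`. -/
def Run (W : ℕ) (p : Program) (s : State) (c : ℕ) (Q : State → Prop) : Prop :=
  ∃ t ≤ c, ∃ s', Exec W p s t s' ∧ Q s'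

theorem Run.mono {W : ℕ} {p : Program} {s : State} {c c' : ℕ} {Q Q' : State → Prop}
    (h : Run W p s c Q) (hc : c ≤ c') (hQ : ∀ s, Q s → Q' s) : Run W p s c' Q' := by
  obtain ⟨t, ht, s', he, hq⟩ := h
  exact ⟨t, ht.trans hc, s', he, hQ _ hq⟩

theorem Run.seq {W : ℕ} {p q : Program} {s : State} {c d : ℕ} {R Q : State → Prop}
    (hp : Run W p s c R) (hq : ∀ s', R s' → Run W q s' d Q) :
    Run W (.seq p q) s (c + d) Q := by
  obtain ⟨t, ht, s', he, hr⟩ := hp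
  obtain ⟨t', ht', s'', he', hQ⟩ := hq s' hr
  exact ⟨t + t', by omega, s'', .seq he he', hQ⟩

/-- Weakest precondition of a program without loops. -/
def wp (W : ℕ) : Program → (State → Prop) → State → Prop
  | .skip, Q, s => Q s
  | .assign x o, Q, s => o.eval s ≤ W ∧ Q (s.setReg x (o.eval s))
  | .store a x y, Q, s => Q (s.setArr a (s.reg x) (s.reg y))
  | .seq p q, Q, s => wp W p (wp W q Q) s
  | .ite b p q, Q, s => (b.Holds s → wp W p Q s) ∧ (¬ b.Holds s → wp W q Q s)
  | .while _ _, _, _ => False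

/-- The largest number of steps of a program without loops. -/
def cost : Program → ℕ
  | .seq p q => cost p + cost q
  | .ite _ p q => max (cost p) (cost q) + 1
  | _ => 1

/-- `wp` is false on loops, so this covers only straight-line and branching code. Nested iteration
is therefore written as a single loop with an amortised measure. -/
theorem Run.of_wp {W : ℕ} : ∀ {p : Program} {Q : State → Prop} {s : State},
    wp W p Q s → Run W p s (cost p) Q
  | .skip, _, s, h => ⟨1, le_rfl, s, .skip s, h⟩
  | .assign x o, _, s, h => ⟨1, le_rfl, _, .assign s x o h.1, h.2⟩
  | .store a x y, _, s, h => ⟨1, le_rfl, _, .store s a x y, h⟩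
  | .seq _ _, _, _, h => Run.seq (Run.of_wp h) fun _ => Run.of_wp
  | .ite b p q, _, s, h => by
      by_cases hb : b.Holds s
      · obtain ⟨t, ht, s', he, hq⟩ := Run.of_wp (h.1 hb)
        exact ⟨t + 1, by simp only [cost]; omega, s', .ite_true hb he, hq⟩
      · obtain ⟨t, ht, s', he, hq⟩ := Run.of_wp (h.2 hb)
        exact ⟨t + 1, by simp only [cost]; omega, s', .ite_false hb he, hq⟩
  | .while _ _, _, _, h => h.elim

/-- A loop whose body has no loops runs in time proportional to a measure that each round
decreases. -/
theorem Run.while {W : ℕ} {b : Test} {p : Program} (I : State → Prop) (μ : State → ℕ)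
    (hI : ∀ s, I s → b.Holds s → wp W p (fun s' => I s' ∧ μ s' < μ s) s) {s : State} {N : ℕ}
    (hs : I s) (hN : μ s ≤ N) :
    Run W (.while b p) s ((cost p + 1) * N + 1) (fun s' => I s' ∧ ¬ b.Holds s') := by
  induction N using Nat.strong_induction_on generalizing s with
  | _ N ih =>
    by_cases hb : b.Holds s
    · obtain ⟨t, ht, s', he, hs', hlt⟩ := Run.of_wp (hI s hs hb)
      obtain ⟨N, rfl⟩ : ∃ k, N = k + 1 := ⟨N - 1, by omega⟩
      obtain ⟨t', ht', s'', he', hQ⟩ := ih N (by omega) hs' (by omega)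
      refine ⟨t + t' + 1, ?_, s'', .while_true hb he he', hQ⟩
      rw [Nat.mul_succ]; omega
    · exact ⟨1, by omega, s, .while_false hb, hs, hb⟩

/-- An initialization followed by a loop. -/
theorem Run.seq_while {W : ℕ} {i : Program} {b : Test} {p : Program} {s : State} {c : ℕ}
    {Q : State → Prop} (I : State → Prop) (μ : State → ℕ) (N : ℕ) (h0 : wp W i I s)
    (hI : ∀ s, I s → b.Holds s → wp W p (fun s' => I s' ∧ μ s' < μ s) s)
    (hN : ∀ s, I s → μ s ≤ N) (hQ : ∀ s, I s → ¬ b.Holds s → Q s)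
    (hc : cost i + ((cost p + 1) * N + 1) ≤ c) : Run W (.seq i (.while b p)) s c Q :=
  ((Run.of_wp h0).seq fun s hs => Run.while I μ hI hs (hN s hs)).mono hc fun s hs => hQ s hs.1 hs.2

@[simp] theorem State.setReg_reg (s : State) (x v y : ℕ) :
    (s.setReg x v).reg y = if y = x then v else s.reg y := by
  simp [State.setReg, Function.update_apply]

@[simp] theorem State.setReg_arr (s : State) (x v a : ℕ) : (s.setReg x v).arr a = s.arr a := rfl

@[simp] theorem State.setArr_reg (s : State) (a k v : ℕ) : (s.setArr a k v).reg = s.reg := rfl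

@[simp] theorem State.setArr_arr (s : State) (a k v b : ℕ) :
    (s.setArr a k v).arr b = if b = a then Function.update (s.arr a) k v else s.arr b := by
  simp [State.setArr, Function.update_apply]

end RAM

/-! ### Orbits and cycles of maps with sink `0` -/

namespace Cayley

/-- `y` is an iterate of `x`. -/
def Leads (G : ℕ → ℕ) (x y : ℕ) : Prop := ∃ k, G^[k] x = y

/-- `x` is a nonzero periodic point. -/
def Cyc (G : ℕ → ℕ) (x : ℕ) : Prop := x ≠ 0 ∧ Leads G (G x) x

/-- `x` is the largest point of a nonzero periodic orbit. -/
def IsMax (G : ℕ → ℕ) (x : ℕ) : Prop := Cyc G x ∧ ∀ y, Leads G x y → y ≤ x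

section Orbits

variable {G H : ℕ → ℕ} {x y z p m : ℕ}

theorem Leads.refl (G : ℕ → ℕ) (x : ℕ) : Leads G x x := ⟨0, rfl⟩

theorem Leads.trans (h : Leads G x y) (h' : Leads G y z) : Leads G x z := by
  obtain ⟨k, rfl⟩ := h
  obtain ⟨l, rfl⟩ := h'
  exact ⟨l + k, Function.iterate_add_apply ..⟩

theorem Leads.single (G : ℕ → ℕ) (x : ℕ) : Leads G x (G x) := ⟨1, rfl⟩

theorem Leads.head (h : Leads G (G x) y) : Leads G x y := (Leads.single G x).trans h

theorem Leads.tail (h : Leads G x y) : Leads G x (G y) := h.trans (.single G y)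

theorem Leads.cases_head (h : Leads G x y) : x = y ∨ Leads G (G x) y := by
  obtain ⟨_ | k, hk⟩ := h
  · exact .inl hk
  · exact .inr ⟨k, hk⟩

theorem Leads.rec_tail {P : ℕ → Prop} (h : Leads G x y) (h0 : P x)
    (hs : ∀ y, Leads G x y → P y → P (G y)) : P y := by
  obtain ⟨k, rfl⟩ := h
  induction k with
  | zero => exact h0
  | succ k ih => rw [Function.iterate_succ_apply']; exact hs _ ⟨k, rfl⟩ ih

/-- Orbits of a map do not branch, so of two points on the same orbit one comes after the other. -/
theorem Leads.total (h : Leads G x y) (h' : Leads G x z) : Leads G y z ∨ Leads G z y := by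
  refine h.rec_tail (P := fun y => Leads G y z ∨ Leads G z y) (.inl h') fun y _ ih => ?_
  rcases ih with ih | ih
  · rcases ih.cases_head with rfl | ih
    · exact .inr (.single ..)
    · exact .inl ih
  · exact .inr ih.tail

theorem Leads.eq_zero (h0 : G 0 = 0) (h : Leads G 0 y) : y = 0 :=
  h.rec_tail (P := fun y => y = 0) rfl fun y _ hy => by rw [hy, h0]

theorem Cyc.leads_symm (hx : Cyc G x) (h : Leads G x y) : Leads G y x := by
  refine h.rec_tail (P := fun y => Leads G y x) (.refl ..) fun y _ ih => ?_
  rcases ih.cases_head with rfl | ih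
  · exact hx.2
  · exact ih

theorem Cyc.of_leads (h0 : G 0 = 0) (hx : Cyc G x) (h : Leads G x y) : Cyc G y := by
  have h' := hx.leads_symm h
  refine ⟨fun hy => hx.1 (Leads.eq_zero h0 (hy ▸ h')), ?_⟩
  rcases h'.cases_head with rfl | h'
  · exact hx.2
  · exact h'.trans h

theorem not_cyc_of_leads_zero (h0 : G 0 = 0) (h : Leads G x 0) : ¬ Cyc G x :=
  fun hx => (hx.of_leads h0 h).1 rfl

theorem IsMax.of_leads_eq (hx : IsMax G x) (hy : IsMax G y) (h : Leads G x y) : x = y :=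
  le_antisymm (hy.2 _ (hx.1.leads_symm h)) (hx.2 _ h)

theorem Cyc.exists_isMax {n : ℕ} (h0 : G 0 = 0) (hn : ∀ x, G x ≤ n) (hx : Cyc G x) :
    ∃ y, IsMax G y ∧ x ≤ y ∧ Leads G x y := by
  have hb : BddAbove {y | Leads G x y} := by
    -- Only values of `G` are bounded by `n`; the starting point `x` needs its own bound.
    refine ⟨max x n, ?_⟩
    rintro y hy
    exact Leads.rec_tail (P := fun y => y ≤ max x n) hy (le_max_left ..)
      fun y _ _ => (hn y).trans (le_max_right ..)
  have hm : Leads G x (sSup {y | Leads G x y}) := Nat.sSup_mem ⟨x, .refl G x⟩ hb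
  exact ⟨_, ⟨hx.of_leads h0 hm, fun y hy => le_csSup hb (hm.trans hy)⟩,
    le_csSup hb (Leads.refl G x), hm⟩

/-- If two maps differ only at `p` and `m`, an orbit of one is an orbit of the other as long as it
does not pass `p` or `m`. -/
theorem Leads.transfer (hGH : ∀ x, x ≠ p → x ≠ m → H x = G x) (h : Leads G x y) :
    Leads H x y ∨ (Leads G x p ∧ Leads G p y ∧ Leads H x p) ∨
      (Leads G x m ∧ Leads G m y ∧ Leads H x m) := by
  refine h.rec_tail (P := fun y => Leads H x y ∨ (Leads G x p ∧ Leads G p y ∧ Leads H x p) ∨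
      (Leads G x m ∧ Leads G m y ∧ Leads H x m)) (.inl (.refl ..)) fun y hy ih => ?_
  rcases ih with ih | ⟨h1, h2, h3⟩ | ⟨h1, h2, h3⟩
  · by_cases hp : y = p
    · subst hp; exact .inr (.inl ⟨hy, .single .., ih⟩)
    by_cases hm : y = m
    · subst hm; exact .inr (.inr ⟨hy, .single .., ih⟩)
    exact .inl (hGH y hp hm ▸ ih.tail)
  · exact .inr (.inl ⟨h1, h2.tail, h3⟩)
  · exact .inr (.inr ⟨h1, h2.tail, h3⟩)

theorem Cyc.transfer (hGH : ∀ x, x ≠ p → x ≠ m → H x = G x) (hx : Cyc G x)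
    (hp : ¬ Leads G x p) (hm : ¬ Leads G x m) : Cyc H x := by
  refine ⟨hx.1, ?_⟩
  have hxp : x ≠ p := fun h => hp (h ▸ .refl ..)
  have hxm : x ≠ m := fun h => hm (h ▸ .refl ..)
  rw [hGH x hxp hxm]
  rcases hx.2.transfer hGH with h | ⟨h, -⟩ | ⟨h, -⟩
  · exact h
  · exact absurd h.head hp
  · exact absurd h.head hm

end Orbits

/-! ### The merging step and its inverse -/

/-- `G` on `[n]` has the root `1`, and the edge of every other vertex stays in `[n]`. -/
structure Rooted (n : ℕ) (G : ℕ → ℕ) : Prop where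
  out : ∀ x, ¬ (1 < x ∧ x ≤ n) → G x = 0
  pos : ∀ x, 1 < x → x ≤ n → 0 < G x
  le : ∀ x, G x ≤ n

/-- `G` has a path from `n` over `p` to the root `1`, and the vertices of its cycles are smaller
than `p`. -/
structure Linked (n : ℕ) (G : ℕ → ℕ) (p : ℕ) : Prop extends Rooted n G where
  one_lt : 1 < p
  last : G p = 1
  path : Leads G n p
  cyc_lt : ∀ x, Cyc G x → x < p

/-- Let `p` inherit the edge of `m`, and let `m` point to the root. -/
def splice (G : ℕ → ℕ) (p m : ℕ) : ℕ → ℕ := Function.update (Function.update G p (G m)) m 1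

section Splice

variable {n : ℕ} {G : ℕ → ℕ} {x y p m : ℕ}

theorem splice_right (G : ℕ → ℕ) (p m : ℕ) : splice G p m m = 1 := by simp [splice]

theorem splice_left (h : p ≠ m) : splice G p m p = G m := by simp [splice, h]

theorem splice_of_ne (hp : x ≠ p) (hm : x ≠ m) : splice G p m x = G x := by simp [splice, hp, hm]

theorem splice_agree : ∀ x, x ≠ p → x ≠ m → splice G p m x = G x := fun _ => splice_of_ne

/-- Exchanging the two vertices undoes the step; `G p = 1` is the value that the second splice has
to restore. -/
theorem splice_splice (h : p ≠ m) (hp : G p = 1) : splice (splice G p m) m p = G := by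
  funext x
  by_cases hx : x = p
  · rw [hx, splice_right, hp]
  by_cases hm : x = m
  · rw [hm, splice_left h.symm, splice_left h]
  · rw [splice_of_ne hm hx, splice_of_ne hx hm]

theorem Rooted.zero (h : Rooted n G) : G 0 = 0 := h.out 0 (by omega)

theorem Rooted.one (h : Rooted n G) : G 1 = 0 := h.out 1 (by omega)

theorem Rooted.not_cyc (h : Rooted n G) (hx : Leads G x 1) : ¬ Cyc G x :=
  not_cyc_of_leads_zero h.zero (h.one ▸ hx.tail)

theorem Rooted.bounds_of_cyc (h : Rooted n G) (hx : Cyc G x) : 1 < x ∧ x ≤ n := by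
  by_contra hc
  refine not_cyc_of_leads_zero h.zero ?_ hx
  exact ⟨1, h.out x hc⟩

theorem Rooted.splice (h : Rooted n G) (hp : 1 < p ∧ p ≤ n) (hm : 1 < m ∧ m ≤ n) :
    Rooted n (splice G p m) where
  out x hx := by
    rw [splice_of_ne (by rintro rfl; exact hx hp) (by rintro rfl; exact hx hm), h.out x hx]
  pos x h1 hn := by
    by_cases hxm : x = m
    · rw [hxm, splice_right]; exact one_pos
    by_cases hxp : x = p
    · rw [hxp, splice_left (hxp ▸ hxm)]; exact h.pos m hm.1 hm.2
    · rw [splice_of_ne hxp hxm]; exact h.pos x h1 hn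
  le x := by
    by_cases hxm : x = m
    · rw [hxm, splice_right]; omega
    by_cases hxp : x = p
    · rw [hxp, splice_left (hxp ▸ hxm)]; exact h.le m
    · rw [splice_of_ne hxp hxm]; exact h.le x

theorem Linked.le_n (h : Linked n G p) : p ≤ n := by
  by_contra hc
  have := h.out p (by omega)
  have := h.last
  omega

theorem Linked.leads_one (h : Linked n G p) : Leads G p 1 := h.last ▸ .single ..

/-- The point `m` is the greatest cyclic vertex; its cycle is inserted into the path behind `p`. -/
structure Merge (n : ℕ) (G : ℕ → ℕ) (p m : ℕ) : Prop where
  linked : Linked n G p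
  cyc : Cyc G m
  le : ∀ x, Cyc G x → x ≤ m

namespace Merge

variable (h : Merge n G p m)
include h

theorem lt : m < p := h.linked.cyc_lt m h.cyc

theorem bounds : 1 < m ∧ m ≤ n := h.linked.toRooted.bounds_of_cyc h.cyc

/-- Since `p` leads to `1` and then to the sink `0`, an orbit through `p` cannot return. -/
theorem not_leads (hx : Cyc G x) : ¬ Leads G x p := fun hp =>
  h.linked.toRooted.not_cyc h.linked.leads_one (hx.of_leads h.linked.zero hp)

theorem rooted : Rooted n (splice G p m) :=
  h.linked.toRooted.splice ⟨h.linked.one_lt, h.linked.le_n⟩ h.bounds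

theorem leads_splice : Leads (splice G p m) p m := by
  refine Leads.head ?_
  rw [splice_left h.lt.ne']
  rcases h.cyc.2.transfer splice_agree with hc | ⟨hc, -⟩ | ⟨-, -, hc⟩
  · exact hc
  · exact absurd hc.head (h.not_leads h.cyc)
  · exact hc

theorem path_left : Leads (splice G p m) n p := by
  rcases h.linked.path.transfer splice_agree with hc | ⟨-, -, hc⟩ | ⟨-, hc, -⟩
  · exact hc
  · exact hc
  · exact absurd hc (h.not_leads h.cyc)

theorem not_cyc_right : ¬ Cyc (splice G p m) m :=
  h.rooted.not_cyc ⟨1, splice_right ..⟩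

/-- After the step both `p` and `m` lead to `1`, so a cycle of the new map avoids the two vertices
where the maps differ. Conversely, a cycle of `G` never meets `p`, and it meets `m` only if it is
the cycle of `m`. -/
theorem cyc_splice : Cyc (splice G p m) x ↔ Cyc G x ∧ ¬ Leads G m x := by
  have h' : ∀ x, x ≠ p → x ≠ m → G x = splice G p m x := fun x hp hm =>
    (splice_of_ne hp hm).symm
  constructor
  · intro hx
    have hm : ¬ Leads (splice G p m) x m := fun hc =>
      h.not_cyc_right (hx.of_leads h.rooted.zero hc)
    have hp : ¬ Leads (splice G p m) x p := fun hc => hm (hc.trans h.leads_splice)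
    have hxG := hx.transfer h' hp hm
    refine ⟨hxG, fun hc => ?_⟩
    rcases (h.cyc.leads_symm hc).transfer splice_agree with hc | ⟨hc, -⟩ | ⟨-, -, hc⟩
    · exact hm hc
    · exact h.not_leads hxG hc
    · exact hm hc
  · rintro ⟨hx, hm⟩
    exact hx.transfer splice_agree (h.not_leads hx) fun hc => hm (hx.leads_symm hc)

theorem linked_splice : Linked n (splice G p m) m where
  toRooted := h.rooted
  one_lt := h.bounds.1
  last := splice_right ..
  path := h.path_left.trans h.leads_splice
  cyc_lt x hx := by
    have := h.cyc_splice.1 hx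
    refine lt_of_le_of_ne (h.le x this.1) ?_
    rintro rfl
    exact this.2 (.refl ..)

theorem isMax_splice : IsMax (splice G p m) x ↔ IsMax G x ∧ x ≠ m := by
  have key : ∀ y, Cyc G x → ¬ Leads G m x → (Leads (splice G p m) x y ↔ Leads G x y) := by
    intro y hx hm
    have hm' : ¬ Leads G x m := fun hc => hm (hx.leads_symm hc)
    have hp := h.not_leads hx
    constructor
    · intro hy
      have h' : ∀ x, x ≠ p → x ≠ m → G x = splice G p m x := fun x hp hm =>
        (splice_of_ne hp hm).symm
      rcases hy.transfer h' with hc | ⟨-, -, hc⟩ | ⟨-, -, hc⟩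
      · exact hc
      · exact absurd hc hp
      · exact absurd hc hm'
    · intro hy
      rcases hy.transfer splice_agree with hc | ⟨hc, -⟩ | ⟨hc, -⟩
      · exact hc
      · exact absurd hc hp
      · exact absurd hc hm'
  have hm : IsMax G m := ⟨h.cyc, fun y hy => h.le y (h.cyc.of_leads h.linked.zero hy)⟩
  constructor
  · rintro ⟨hx, hy⟩
    have hx' := h.cyc_splice.1 hx
    refine ⟨⟨hx'.1, fun y hxy => hy y ((key y hx'.1 hx'.2).2 hxy)⟩, ?_⟩
    rintro rfl
    exact h.not_cyc_right hx
  · rintro ⟨hx, hxm⟩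
    have hm' : ¬ Leads G m x := fun hc => hxm (hm.of_leads_eq hx hc).symm
    exact ⟨h.cyc_splice.2 ⟨hx.1, hm'⟩, fun y hy => hx.2 y ((key y hx.1 hm').1 hy)⟩

/-- Behind `p`, the new path has no vertex larger than `m`. -/
theorem le_of_leads (hx : Leads (splice G p m) (splice G p m p) x) : x ≤ m := by
  have hm := h.bounds
  suffices Cyc G x ∨ x = 1 ∨ x = 0 by
    rcases this with hx | hx | hx
    · exact h.le x hx
    · omega
    · omega
  refine hx.rec_tail (P := fun x => Cyc G x ∨ x = 1 ∨ x = 0) ?_ ?_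
  · rw [splice_left h.lt.ne']
    exact .inl (h.cyc.of_leads h.linked.zero (.single ..))
  · rintro y - (hy | rfl | rfl)
    · by_cases hym : y = m
      · exact .inr (.inl (hym ▸ splice_right ..))
      · have hyp : y ≠ p := by rintro rfl; exact h.not_leads hy (.refl ..)
        rw [splice_of_ne hyp hym]
        exact .inl (hy.of_leads h.linked.zero (.single ..))
    · exact .inr (.inr h.rooted.one)
    · exact .inr (.inr h.rooted.zero)

end Merge

/-- A merging step is determined by its result. -/
theorem Merge.injective {G' : ℕ → ℕ} {p' : ℕ} (h : Merge n G p m) (h' : Merge n G' p' m)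
    (heq : splice G p m = splice G' p' m) : G = G' ∧ p = p' := by
  have hp : p = p' := by
    -- Both `p` and `p'` lie on the orbit of `n`. If they differed, the later one would lie behind
    -- the other and be at most `m`, but both exceed `m`.
    have hq := h'.path_left
    rw [← heq] at hq
    rcases h.path_left.total hq with hc | hc
    · rcases hc.cases_head with rfl | hc
      · rfl
      · have := h.le_of_leads hc
        have := h'.lt
        omega
    · rcases hc.cases_head with rfl | hc
      · rfl
      · have := h'.le_of_leads (heq ▸ hc)
        have := h.lt
        omega
  subst hp
  refine ⟨?_, rfl⟩
  rw [← splice_splice h.lt.ne' h.linked.last, heq, splice_splice h.lt.ne' h'.linked.last]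

/-- The inverse of a merging step. -/
theorem Linked.unmerge (h : Linked n G m) (hnp : Leads G n p) (hpm : Leads G p m) (hmp : m < p)
    (hle : ∀ x, Leads G (G p) x → x ≤ m) : Merge n (splice G m p) p m := by
  have hagree : ∀ x, x ≠ m → x ≠ p → Cayley.splice G m p x = G x := fun _ => splice_of_ne
  have h1 := h.one_lt
  have hpn : p ≤ n := by
    by_contra hc
    rcases hpm.cases_head with rfl | hpm
    · omega
    · rw [h.out p (by omega)] at hpm
      have := hpm.eq_zero h.zero
      omega
  have hroot : Rooted n (Cayley.splice G m p) :=
    h.toRooted.splice ⟨h1, h.le_n⟩ ⟨by omega, hpn⟩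
  have hcp : ¬ Cyc (Cayley.splice G m p) p := hroot.not_cyc ⟨1, splice_right ..⟩
  have hpp : ¬ Leads G (G p) p := fun hc => by have := hle p hc; omega
  have hGp : Leads G (G p) m := by
    rcases hpm.cases_head with rfl | hpm
    · omega
    · exact hpm
  have hcyc : Cyc (Cayley.splice G m p) m := by
    refine ⟨by omega, ?_⟩
    rw [splice_left hmp.ne]
    rcases hGp.transfer hagree with hc | ⟨-, -, hc⟩ | ⟨hc, -⟩
    · exact hc
    · exact hc
    · exact absurd hc hpp
  have hpath : Leads (Cayley.splice G m p) n p := by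
    rcases hnp.transfer hagree with hc | ⟨-, hc, -⟩ | ⟨-, -, hc⟩
    · exact hc
    · rcases hc.cases_head with rfl | hc
      · omega
      · rw [h.last] at hc
        rcases hc.cases_head with hc | hc
        · omega
        · rw [h.one] at hc
          have := hc.eq_zero h.zero
          omega
    · exact hc
  -- The stretch behind `p` is closed up at `m`, so the new orbit of `m` stays among the old
  -- vertices behind `p`.
  have hclosed : ∀ x, Leads (Cayley.splice G m p) m x → Leads G (G p) x := by
    intro x hx
    refine hx.rec_tail (P := fun x => Leads G (G p) x) hGp fun y _ hy => ?_
    by_cases hym : y = m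
    · rw [hym, splice_left hmp.ne]; exact .refl ..
    · by_cases hyp : y = p
      · exact absurd (hyp ▸ hy) hpp
      · rw [splice_of_ne hym hyp]; exact hy.tail
  -- A cycle through `m` is bounded by `hle`; any other avoids `m` and `p`, is therefore an old
  -- cycle, and lies below `m` by `cyc_lt`.
  have hmax : ∀ x, Cyc (Cayley.splice G m p) x → x ≤ m := by
    intro x hx
    by_cases hxm : Leads (Cayley.splice G m p) x m
    · exact hle x (hclosed x (hx.leads_symm hxm))
    · have hxp : ¬ Leads (Cayley.splice G m p) x p := fun hc =>
        hcp (hx.of_leads hroot.zero hc)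
      exact (h.cyc_lt x (hx.transfer (fun x hm hp => (splice_of_ne hm hp).symm) hxm hxp)).le
  exact ⟨⟨hroot, by omega, splice_right .., hpath, fun x hx => (hmax x hx).trans_lt hmp⟩,
    hcyc, hmax⟩

end Splice

/-! ### Iterating the merging step -/

/-- Insert the cycles with the maxima `ms` one after the other into the path that ends in `p`. -/
def relink : ℕ → List ℕ → (ℕ → ℕ) → (ℕ → ℕ)
  | _, [], G => G
  | p, m :: ms, G => relink m ms (splice G p m)

section Relink

variable {n : ℕ} {G : ℕ → ℕ} {x p m : ℕ} {ms : List ℕ}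

theorem relink_of_notMem (hp : x ≠ p) (hx : x ∉ ms) : relink p ms G x = G x := by
  induction ms generalizing p G with
  | nil => rfl
  | cons m ms ih =>
    rw [List.mem_cons, not_or] at hx
    rw [relink, ih hx.1 hx.2, splice_of_ne hp hx.1]

/-- Each splice hands the value at the next maximum to the current end of the path. The values along
`p :: ms` thus shift by one place, and the last becomes `1`: these are the new edges of Θ. -/
theorem zip_relink (hnd : (p :: ms).Nodup) (hp : G p = 1) :
    List.zip (p :: ms) (ms.map G ++ [1]) = (p :: ms).map fun x => (x, relink p ms G x) := by
  induction ms generalizing p G with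
  | nil => simp [relink, hp]
  | cons m ms ih =>
    rw [List.nodup_cons] at hnd
    have hpm : p ≠ m := fun h => hnd.1 (h ▸ List.mem_cons_self ..)
    have hpms : p ∉ ms := fun h => hnd.1 (List.mem_cons_of_mem _ h)
    have hmm : m ∉ ms := (List.nodup_cons.1 hnd.2).1
    have hmap : ms.map G = ms.map (splice G p m) := by
      refine List.map_congr_left fun x hx => (splice_of_ne ?_ ?_).symm
      · rintro rfl; exact hpms hx
      · rintro rfl; exact hmm hx
    rw [List.map_cons, List.cons_append, List.zip_cons_cons, hmap,
      ih hnd.2 (splice_right ..), List.map_cons (l := m :: ms), relink,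
      relink_of_notMem hpm hpms, splice_left hpm]

/-- `ms` lists the maxima of the cycles of `G` in decreasing order. -/
def IsMaxList (G : ℕ → ℕ) (ms : List ℕ) : Prop :=
  ms.Pairwise (· > ·) ∧ ∀ x, x ∈ ms ↔ IsMax G x

/-- Every cyclic vertex is bounded by the maximum of its own cycle, which is in the list and so at
most its head. -/
theorem IsMaxList.merge (h : Linked n G p) (hms : IsMaxList G (m :: ms)) : Merge n G p m := by
  refine ⟨h, ((hms.2 m).1 (List.mem_cons_self ..)).1, fun x hx => ?_⟩
  obtain ⟨y, hy, hxy, -⟩ := hx.exists_isMax h.zero h.le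
  rcases List.mem_cons.1 ((hms.2 y).2 hy) with rfl | hym
  · exact hxy
  · exact hxy.trans (List.rel_of_pairwise_cons hms.1 hym).le

theorem IsMaxList.tail (h : Linked n G p) (hms : IsMaxList G (m :: ms)) :
    IsMaxList (splice G p m) ms := by
  have hM := hms.merge h
  refine ⟨(List.pairwise_cons.1 hms.1).2, fun x => ?_⟩
  rw [hM.isMax_splice, ← hms.2, List.mem_cons]
  constructor
  · intro hx
    exact ⟨.inr hx, (List.rel_of_pairwise_cons hms.1 hx).ne⟩
  · rintro ⟨hx | hx, hne⟩
    · exact absurd hx hne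
    · exact hx

theorem Linked.relink (h : Linked n G p) (hms : IsMaxList G ms) :
    ∃ q, Linked n (relink p ms G) q ∧ ∀ x, ¬ Cyc (Cayley.relink p ms G) x := by
  induction ms generalizing p G with
  | nil =>
    refine ⟨p, h, fun x hx => ?_⟩
    obtain ⟨y, hy, -⟩ := hx.exists_isMax h.zero h.le
    exact absurd ((hms.2 y).2 hy) (List.not_mem_nil)
  | cons m ms ih => exact ih (hms.merge h).linked_splice (hms.tail h)

/-- The last vertex of the path to the root is unique. -/
theorem Linked.unique {q : ℕ} (h : Linked n G p) (h' : Linked n G q) : p = q := by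
  have key : ∀ {p q}, Linked n G p → Linked n G q → Leads G p q → p = q := by
    intro p q h h' hc
    rcases hc.cases_head with hc | hc
    · exact hc
    · rw [h.last] at hc
      exact absurd h'.one_lt (by
        rcases hc.cases_head with hc | hc
        · omega
        · rw [h.one] at hc
          have := hc.eq_zero h.zero
          omega)
  rcases h.path.total h'.path with hc | hc
  · exact key h h' hc
  · exact (key h' h hc).symm

/-- One merging step between states that consist of a map and the end of its path. -/
def MergeStep (n : ℕ) (a b : (ℕ → ℕ) × ℕ) : Prop :=
  Merge n a.1 a.2 b.2 ∧ b.1 = splice a.1 a.2 b.2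

/-- Merging forwards is deterministic, as the greatest cyclic vertex is unique. Any chain of steps
that ends without cycles is therefore the one that `relink` performs. -/
theorem MergeStep.relink_eq {T : ℕ → ℕ} {q : ℕ}
    (hc : Relation.ReflTransGen (MergeStep n) (G, p) (T, q))
    (hT : ∀ x, ¬ Cyc T x) (hms : IsMaxList G ms) : relink p ms G = T := by
  suffices ∀ a b, Relation.ReflTransGen (MergeStep n) a b → (∀ x, ¬ Cyc b.1 x) →
      ∀ ms, IsMaxList a.1 ms → relink a.2 ms a.1 = b.1 from this _ _ hc hT ms hms
  intro a b hc hT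
  induction hc using Relation.ReflTransGen.head_induction_on with
  | refl =>
    rintro (_ | ⟨m, ms⟩) hms
    · rfl
    · exact absurd ((hms.2 m).1 (List.mem_cons_self ..)).1 (hT m)
  | @head a c h hc ih =>
    obtain ⟨h, heq⟩ := h
    have hm : IsMax a.1 c.2 := ⟨h.cyc, fun y hy => h.le y (h.cyc.of_leads h.linked.zero hy)⟩
    rintro (_ | ⟨m, ms⟩) hms
    · exact absurd ((hms.2 _).2 hm) (List.not_mem_nil)
    · obtain rfl : m = c.2 :=
        le_antisymm (h.le _ (hms.merge h.linked).cyc) ((hms.merge h.linked).le _ h.cyc)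
      rw [relink, ← heq]
      exact ih ms (heq ▸ hms.tail h.linked)

theorem Linked.mergeSteps_relink (h : Linked n G p) (hms : IsMaxList G ms) :
    ∃ q, Linked n (Cayley.relink p ms G) q ∧
      Relation.ReflTransGen (MergeStep n) (G, p) (Cayley.relink p ms G, q) := by
  induction ms generalizing p G with
  | nil => exact ⟨p, h, .refl⟩
  | cons m ms ih =>
    obtain ⟨q, hq, hc⟩ := ih (hms.merge h).linked_splice (hms.tail h)
    exact ⟨q, hq, hc.head ⟨hms.merge h, rfl⟩⟩

theorem MergeStep.lt {a b : (ℕ → ℕ) × ℕ} (h : MergeStep n a b) : b.2 < n :=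
  h.1.lt.trans_le h.1.linked.le_n

/-- The chains are compared from their common end. Injectivity of a step identifies the
predecessors, and neither chain can stop before the other because the state after any step has its
second component below `n`. -/
theorem MergeStep.start_unique {a b c : (ℕ → ℕ) × ℕ}
    (ha : Relation.ReflTransGen (MergeStep n) a c) (hb : Relation.ReflTransGen (MergeStep n) b c)
    (han : a.2 = n) (hbn : b.2 = n) : a = b := by
  induction ha with
  | refl =>
    rcases Relation.ReflTransGen.cases_tail hb with hb | ⟨d, -, hd⟩
    · exact hb
    · exact absurd han hd.lt.ne
  | @tail d c _ hd ih =>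
    rcases Relation.ReflTransGen.cases_tail hb with rfl | ⟨e, hbe, he⟩
    · exact absurd hbn hd.lt.ne
    · have := hd.1.injective he.1 (hd.2 ▸ he.2)
      exact ih (Prod.ext this.1 this.2 ▸ hbe)

theorem relink_injective {G' : ℕ → ℕ} {ms' : List ℕ} (h : Linked n G n)
    (hms : IsMaxList G ms) (h' : Linked n G' n) (hms' : IsMaxList G' ms')
    (heq : relink n ms G = relink n ms' G') : G = G' := by
  obtain ⟨q, hq, hc⟩ := h.mergeSteps_relink hms
  obtain ⟨q', hq', hc'⟩ := h'.mergeSteps_relink hms'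
  rw [← heq] at hq' hc'
  obtain rfl := hq.unique hq'
  exact congrArg Prod.fst (MergeStep.start_unique hc hc' rfl rfl)

end Relink

end Cayley

/-! ### Translation between digraphs and tables -/

namespace Cayley

/-- The digraph on `[n]` with the edges `⟨i, A i⟩` where `A i` lies in `[n]`. -/
def graphOf (n : ℕ) (A : ℕ → ℕ) : Digraph (Vertex n) where
  Adj i j := A i = j

/-- The values of `f`, and `0` elsewhere. -/
def table {n : ℕ} (f : Fn n) (x : ℕ) : ℕ := if h : x ∈ Set.Ioo 1 n then f ⟨x, h⟩ else 0

/-- The edges of `f` and the edge `⟨n, 1⟩`. -/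
def rootedTable {n : ℕ} (f : Fn n) : ℕ → ℕ := Function.update (table f) n 1

section Tables

variable {n : ℕ} {f : Fn n} {x : ℕ}

theorem table_coe (k : Inner n) : table f k = f k := by
  simp only [table, dif_pos k.2, Subtype.coe_eta]

theorem table_of_notMem (h : x ∉ Set.Ioo 1 n) : table f x = 0 := dif_neg h

theorem table_le (x : ℕ) : table f x ≤ n := by
  unfold table
  split_ifs with h
  · exact (f _).2.2
  · exact Nat.zero_le n

theorem graph_eq_graphOf : graph f = graphOf n (table f) := by
  ext i j
  constructor
  · rintro ⟨k, hk, rfl⟩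
    change table f i = _
    rw [← hk, table_coe]
  · intro h
    change table f i = j at h
    by_cases hi : (i : ℕ) ∈ Set.Ioo 1 n
    · refine ⟨⟨i, hi⟩, rfl, Subtype.ext ?_⟩
      rw [← h, ← table_coe]
    · rw [table_of_notMem hi] at h
      have := j.2.1
      omega

theorem exists_table {A : ℕ → ℕ} (out : ∀ x, x ∉ Set.Ioo 1 n → A x = 0)
    (pos : ∀ x, x ∈ Set.Ioo 1 n → 0 < A x) (le : ∀ x, A x ≤ n) : ∃ f : Fn n, table f = A := by
  refine ⟨fun k => ⟨A k, pos _ k.2, le _⟩, ?_⟩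
  funext x
  by_cases hx : x ∈ Set.Ioo 1 n
  · exact table_coe ⟨x, hx⟩
  · rw [table_of_notMem hx, out x hx]

theorem rootedTable_coe (k : Inner n) : rootedTable f k = f k := by
  rw [rootedTable, Function.update_of_ne k.2.2.ne, table_coe]

theorem rootedTable_self : rootedTable f n = 1 := Function.update_self ..

/-- The path from `p = n` to the root is the single added edge, and `n` is not cyclic because
nothing leaves `1`. -/
theorem linked_rootedTable (hn : 2 ≤ n) : Linked n (rootedTable f) n := by
  have hroot : Rooted n (rootedTable f) := by
    refine ⟨fun x hx => ?_, fun x h1 hx => ?_, fun x => ?_⟩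
    · rw [rootedTable, Function.update_of_ne (by omega), table_of_notMem]
      rintro ⟨h1, h2⟩
      omega
    · rcases eq_or_lt_of_le hx with rfl | hx
      · rw [rootedTable_self]; exact one_pos
      · exact rootedTable_coe (f := f) ⟨x, h1, hx⟩ ▸ (f _).2.1
    · by_cases hx : x = n
      · rw [hx, rootedTable_self]; omega
      · rw [rootedTable, Function.update_of_ne hx]
        exact table_le x
  refine ⟨hroot, hn, rootedTable_self, .refl .., fun x hx => ?_⟩
  refine lt_of_le_of_ne (hroot.bounds_of_cyc hx).2 ?_
  rintro rfl
  exact hroot.not_cyc ⟨1, rootedTable_self⟩ hx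

theorem Reaches.leads {u v : Vertex n} (h : Reaches f u v) :
    Leads (rootedTable f) (rootedTable f u) v := by
  have adj : ∀ u v : Vertex n, (graph f).Adj u v → rootedTable f u = v := by
    rintro u v ⟨k, hk, rfl⟩
    rw [← hk, rootedTable_coe]
  induction h with
  | single h => exact adj _ _ h ▸ .refl ..
  | tail _ h ih => exact adj _ _ h ▸ ih.tail

theorem Reaches.of_leads (hn : 2 ≤ n) {u v : Vertex n} (hu : Cyc (rootedTable f) u)
    (h : Leads (rootedTable f) (rootedTable f u) v) : Reaches f u v := by
  have hL := linked_rootedTable (f := f) hn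
  have key : ∀ x, Cyc (rootedTable f) x → ∃ k : Inner n, (k : ℕ) = x := fun x hx =>
    ⟨⟨x, (hL.bounds_of_cyc hx).1, hL.cyc_lt x hx⟩, rfl⟩
  suffices ∃ w : Vertex n, (w : ℕ) = v ∧ Reaches f u w by
    obtain ⟨w, hw, h⟩ := this
    exact Subtype.ext hw ▸ h
  refine h.rec_tail (P := fun x => ∃ w : Vertex n, (w : ℕ) = x ∧ Reaches f u w) ?_ ?_
  · obtain ⟨k, hk⟩ := key _ hu
    exact ⟨f k, by rw [← hk, rootedTable_coe], .single ⟨k, hk, rfl⟩⟩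
  · rintro y hy ⟨w, rfl, hw⟩
    obtain ⟨k, hk⟩ := key _ (hu.of_leads hL.zero hy.head)
    exact ⟨f k, by rw [← hk, rootedTable_coe], hw.tail ⟨k, hk, rfl⟩⟩

/-- The added edge lies on no cycle, so `f` and `rootedTable f` have the same cycles. -/
theorem isCycleMax_iff (hn : 2 ≤ n) {m : Inner n} :
    IsCycleMax f m ↔ IsMax (rootedTable f) m := by
  have hL := linked_rootedTable (f := f) hn
  constructor
  · rintro ⟨u, hu, huu, hmax⟩
    have hc : Cyc (rootedTable f) u := ⟨by have := u.2.1; omega, huu.leads⟩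
    rw [← hu]
    refine ⟨hc, fun y hy => ?_⟩
    have hyc := hc.of_leads hL.zero hy
    have hb := hL.bounds_of_cyc hyc
    have hy1 := (hc.2.trans hy)
    have hy2 := (hyc.2.trans (hc.leads_symm hy))
    exact hmax ⟨y, hb.1.le, hb.2⟩ (.of_leads hn hc hy1) (.of_leads hn hyc hy2)
  · rintro ⟨hc, hmax⟩
    refine ⟨⟨m, m.2.1.le, m.2.2.le⟩, rfl, .of_leads hn hc hc.2, fun v hv _ => ?_⟩
    exact hmax v hv.leads.head

theorem isMaxList_cycleMaxima (hn : 2 ≤ n) :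
    IsMaxList (rootedTable f) ((cycleMaxima f).map Subtype.val) := by
  have hL := linked_rootedTable (f := f) hn
  classical
  constructor
  · rw [List.pairwise_map]
    exact (Finset.sortedGT_sort _).pairwise
  · intro x
    simp only [cycleMaxima, List.mem_map, Finset.mem_sort, Finset.mem_filter, Finset.mem_univ,
      true_and]
    constructor
    · rintro ⟨m, hm, rfl⟩
      exact (isCycleMax_iff hn).1 hm
    · intro hx
      exact ⟨⟨x, (hL.bounds_of_cyc hx.1).1, hL.cyc_lt x hx.1⟩, (isCycleMax_iff hn).2 hx, rfl⟩

theorem IsMaxList.unique {G : ℕ → ℕ} {ms ms' : List ℕ} (h : IsMaxList G ms)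
    (h' : IsMaxList G ms') : ms = ms' := by
  refine List.Perm.eq_of_pairwise (le := (· > ·)) (fun a b _ _ h1 h2 => absurd h1 h2.asymm)
    h.1 h'.1 ?_
  refine (List.perm_ext_iff_of_nodup (h.1.imp ne_of_gt) (h'.1.imp ne_of_gt)).2 fun x => ?_
  rw [h.2, h'.2]

/-- The list of maxima is left arbitrary, so that the list found by the scan can replace
`cycleMaxima`. -/
theorem theta_eq_graphOf (hn : 2 ≤ n) {ms : List ℕ} (hms : IsMaxList (rootedTable f) ms) :
    theta f = graphOf n (relink n ms (rootedTable f)) := by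
  have hL := linked_rootedTable (f := f) hn
  have hmsc := isMaxList_cycleMaxima (f := f) hn
  have hcm : (cycleMaxima f).map Subtype.val = ms := hmsc.unique hms
  have hnd : (n :: ms).Nodup := by
    refine List.nodup_cons.2 ⟨fun h => ?_, hms.1.imp ne_of_gt⟩
    exact (hL.cyc_lt n ((hms.2 n).1 h).1).ne rfl
  have hne : newEdges f = (n :: ms).map fun x => (x, relink n ms (rootedTable f) x) := by
    rw [← zip_relink hnd rootedTable_self, newEdges, ← hcm, List.map_map]
    congr 2
    · simp [List.pure_def, List.bind_eq_flatMap]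
    · exact List.map_congr_left fun m _ => (rootedTable_coe m).symm
  ext i j
  change (_ ∨ _) ↔ relink n ms (rootedTable f) i = j
  rw [hne]
  constructor
  · rintro (⟨⟨k, hk, hj⟩, hnot⟩ | h)
    · rw [relink_of_notMem (by rw [← hk]; exact k.2.2.ne), ← hk, rootedTable_coe, hj]
      intro hi
      rw [← hcm, List.mem_map] at hi
      obtain ⟨m, hm, hmi⟩ := hi
      obtain rfl : m = k := Subtype.ext (hmi.trans hk.symm)
      exact hnot ⟨m, hm, hmi, hj⟩
    · obtain ⟨x, -, hx⟩ := List.mem_map.1 h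
      rw [Prod.mk.injEq] at hx
      rw [← hx.1, hx.2]
  · intro h
    by_cases hi : (i : ℕ) ∈ n :: ms
    · exact .inr (List.mem_map.2 ⟨i, hi, by rw [h]⟩)
    · rw [List.mem_cons, not_or] at hi
      rw [relink_of_notMem hi.1 hi.2] at h
      have hi1 : 1 < (i : ℕ) := by
        by_contra hc
        have := hL.out i (by omega)
        have := j.2.1
        omega
      have hin : (i : ℕ) < n := lt_of_le_of_ne i.2.2 hi.1
      refine .inl ⟨⟨⟨i, hi1, hin⟩, rfl, Subtype.ext ?_⟩, ?_⟩
      · rw [← h, ← rootedTable_coe]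
      · rintro ⟨m, hm, hmi, -⟩
        exact hi.2 (hcm ▸ List.mem_map.2 ⟨m, hm, hmi⟩)

end Tables

/-! ### Rooted maps without cycles are the trees -/

section Trees

variable {n : ℕ} {A : ℕ → ℕ}

theorem Rooted.leads_one (h : Rooted n A) (hc : ∀ x, ¬ Cyc A x) {x : ℕ} (h1 : 1 ≤ x) (hx : x ≤ n) :
    Leads A x 1 := by
  by_contra hno
  have hmem : ∀ k, A^[k] x ∈ Set.Icc 1 n := by
    intro k
    induction k with
    | zero => exact ⟨h1, hx⟩
    | succ k ih =>
      rw [Function.iterate_succ_apply']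
      refine ⟨h.pos _ (lt_of_le_of_ne ih.1 fun hk => hno ⟨k, hk.symm⟩) ih.2, h.le _⟩
  -- An orbit that misses `1` stays in the finite set `[n]`; a repeated value would be a cyclic
  -- vertex.
  obtain ⟨i, j, hij, heq⟩ := Finite.exists_ne_map_eq_of_infinite
    fun k : ℕ => (⟨A^[k] x, hmem k⟩ : Set.Icc 1 n)
  rw [Subtype.mk.injEq] at heq
  wlog hlt : i < j generalizing i j
  · exact this j i hij.symm heq.symm (by omega)
  obtain ⟨d, rfl⟩ := Nat.exists_eq_add_of_lt hlt
  refine hc (A^[i] x) ⟨by have := (hmem i).1; omega, d, ?_⟩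
  rw [← Function.iterate_succ_apply' A i, ← Function.iterate_add_apply, heq]
  congr 1
  omega

theorem Rooted.graphOf_mem_Trees (hn : 1 ≤ n) (h : Rooted n A) (hc : ∀ x, ¬ Cyc A x) :
    graphOf n A ∈ Trees n := by
  have hpos : ∀ v : Vertex n, (v : ℕ) ≠ 1 → 0 < A v := fun v hv =>
    h.pos v (lt_of_le_of_ne v.2.1 hv.symm) v.2.2
  refine ⟨⟨1, le_rfl, hn⟩, rfl, fun v hv => ?_, fun v hv => ?_, fun v => ?_⟩
  · change A 1 = v at hv
    have := v.2.1
    rw [h.one] at hv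
    omega
  · refine ⟨⟨A v, hpos v fun hv' => hv (Subtype.ext hv'), h.le _⟩, rfl, fun w hw => ?_⟩
    exact Subtype.ext (Eq.symm hw)
  · obtain ⟨k, hk⟩ := h.leads_one hc v.2.1 v.2.2
    induction k generalizing v with
    | zero => exact (Subtype.ext hk : v = ⟨1, le_rfl, hn⟩) ▸ .refl
    | succ k ih =>
      by_cases hv : (v : ℕ) = 1
      · exact (Subtype.ext hv : v = ⟨1, le_rfl, hn⟩) ▸ .refl
      · have hvw : (graphOf n A).Adj v ⟨A v, hpos v hv, h.le _⟩ := rfl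
        exact .head hvw (ih _ hk)

theorem exists_graphOf_of_mem_Trees {T : Digraph (Vertex n)} (hT : T ∈ Trees n) :
    ∃ A, graphOf n A = T ∧ Rooted n A ∧ ∀ x, ¬ Cyc A x := by
  obtain ⟨r, hr, hT⟩ := hT
  have hex : ∀ x : ℕ, ∃ y : ℕ, (∀ h : 1 < x ∧ x ≤ n, ∃ w : Vertex n, T.Adj ⟨x, h.1.le, h.2⟩ w ∧ y = w) ∧
      (¬ (1 < x ∧ x ≤ n) → y = 0) := by
    intro x
    by_cases hx : 1 < x ∧ x ≤ n
    · obtain ⟨w, hw, -⟩ := hT.out_unique ⟨x, hx.1.le, hx.2⟩ (by rintro rfl; exact hx.1.ne' hr)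
      exact ⟨w, fun _ => ⟨w, hw, rfl⟩, fun h => absurd hx h⟩
    · exact ⟨0, fun h => absurd h hx, fun _ => rfl⟩
  choose A hA hA0 using hex
  have hadj : ∀ i j, T.Adj i j ↔ A i = j := by
    intro i j
    by_cases hi : 1 < (i : ℕ) ∧ (i : ℕ) ≤ n
    · obtain ⟨w, hw, hAw⟩ := hA i hi
      constructor
      · intro hj
        rw [hAw, (hT.out_unique i (by rintro rfl; exact hi.1.ne' hr)).unique hw hj]
      · intro hj
        exact (Subtype.ext (hAw.symm.trans hj) : w = j) ▸ hw
    · have hir : i = r := Subtype.ext (by have := i.2.1; have := i.2.2; omega)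
      have := j.2.1
      rw [hA0 i hi]
      exact ⟨fun h => absurd (hir ▸ h) (hT.root_out j), fun h => by omega⟩
  have hroot : Rooted n A := by
    refine ⟨hA0, fun x h1 hx => ?_, fun x => ?_⟩
    · obtain ⟨w, -, hw⟩ := hA x ⟨h1, hx⟩
      exact hw ▸ w.2.1
    · by_cases hx : 1 < x ∧ x ≤ n
      · obtain ⟨w, -, hw⟩ := hA x hx
        exact hw ▸ w.2.2
      · rw [hA0 x hx]; exact Nat.zero_le n
  refine ⟨A, by ext i j; exact (hadj i j).symm, hroot, fun x hx => ?_⟩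
  have hb := hroot.bounds_of_cyc hx
  have hpath := hT.path_to_root ⟨x, hb.1.le, hb.2⟩
  refine hroot.not_cyc ?_ hx
  have : ∀ v, Relation.ReflTransGen T.Adj ⟨x, hb.1.le, hb.2⟩ v → Leads A x v := by
    intro v hv
    induction hv with
    | refl => exact .refl ..
    | tail _ h ih => exact (hadj _ _).1 h ▸ ih.tail
  exact hr ▸ this r hpath

theorem theta_mem_Trees (hn : 2 ≤ n) (f : Fn n) : theta f ∈ Trees n := by
  have hms := isMaxList_cycleMaxima (f := f) hn
  obtain ⟨q, hq, hc⟩ := (linked_rootedTable (f := f) hn).relink hms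
  rw [theta_eq_graphOf hn hms]
  exact hq.toRooted.graphOf_mem_Trees (by omega) hc

theorem graphOf_injective {B : ℕ → ℕ} (hA : Rooted n A) (hB : Rooted n B)
    (h : graphOf n A = graphOf n B) : A = B := by
  funext x
  by_cases hx : 1 < x ∧ x ≤ n
  · have : (graphOf n A).Adj ⟨x, hx.1.le, hx.2⟩ ⟨A x, hA.pos x hx.1 hx.2, hA.le x⟩ := rfl
    rw [h] at this
    exact Eq.symm this
  · rw [hA.out x hx, hB.out x hx]

theorem theta_injective (hn : 2 ≤ n) : Function.Injective (theta (n := n)) := by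
  intro f g h
  have hf := isMaxList_cycleMaxima (f := f) hn
  have hg := isMaxList_cycleMaxima (f := g) hn
  have hLf := linked_rootedTable (f := f) hn
  have hLg := linked_rootedTable (f := g) hn
  obtain ⟨q, hq, -⟩ := hLf.relink hf
  obtain ⟨q', hq', -⟩ := hLg.relink hg
  rw [theta_eq_graphOf hn hf, theta_eq_graphOf hn hg] at h
  have heq := relink_injective hLf hf hLg hg (graphOf_injective hq.toRooted hq'.toRooted h)
  funext k
  exact Subtype.ext (by rw [← rootedTable_coe, ← rootedTable_coe, heq])

end Trees

end Cayley

/-! ### Finding the cyclic vertices -/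

namespace Cayley

section Peel

variable {n : ℕ} {G : ℕ → ℕ} {v u : ℕ} {deg rem : ℕ → ℕ}

/-- The vertices of `[n]` that are not marked. -/
def unmarked (n : ℕ) (rem : ℕ → ℕ) : Finset ℕ := {x ∈ Finset.Icc 1 n | rem x = 0}

theorem mem_unmarked {x : ℕ} : x ∈ unmarked n rem ↔ (1 ≤ x ∧ x ≤ n) ∧ rem x = 0 := by
  simp [unmarked]

theorem card_unmarked_le : (unmarked n rem).card ≤ n :=
  (Finset.card_filter_le ..).trans (by simp)

theorem unmarked_update : unmarked n (Function.update rem u 1) = (unmarked n rem).erase u := by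
  ext x
  rw [Finset.mem_erase, mem_unmarked, mem_unmarked]
  by_cases hx : x = u
  · simp [hx]
  · simp [hx]

theorem card_unmarked_update_lt (h1 : 1 ≤ u) (hu : u ≤ n) (h : rem u = 0) :
    (unmarked n (Function.update rem u 1)).card < (unmarked n rem).card := by
  rw [unmarked_update]
  exact Finset.card_erase_lt_of_mem (mem_unmarked.2 ⟨⟨h1, hu⟩, h⟩)

/-- Invariant of the removal of the vertices that have no incoming edges, where the vertices below
`v` were inspected and `u` is the next vertex to remove; `deg` counts the incoming edges from
vertices that are not removed. -/
structure PeelInv (n : ℕ) (G : ℕ → ℕ) (v u : ℕ) (deg rem : ℕ → ℕ) : Prop where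
  bounds : (v ≤ n ∧ u ≤ n) ∨ (v = n + 1 ∧ u = n + 1)
  rem_zero : rem 0 = 1
  rem_le : ∀ x, rem x ≤ 1
  deg_eq : ∀ w, deg w = {x ∈ unmarked n rem | G x = w}.card
  not_cyc : ∀ x, 1 ≤ x → rem x ≠ 0 → ¬ Cyc G x
  inspected : ∀ x, 1 ≤ x → x ≤ v → x ≤ n → x ≠ u → rem x ≠ 0 ∨ deg x ≠ 0

theorem PeelInv.deg_le (h : PeelInv n G v u deg rem) (w : ℕ) : deg w ≤ n := by
  rw [h.deg_eq]
  exact (Finset.card_filter_le ..).trans card_unmarked_le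

/-- The only count that changes is that of `G u`, which becomes the next candidate and is exempt
from `inspected`. The chain stops at the sink, since `0` is marked from the start. -/
theorem PeelInv.remove (hG : Rooted n G) (h : PeelInv n G v u deg rem) (hu : u ≤ n)
    (hd : deg u + rem u = 0) :
    PeelInv n G v (G u) (Function.update deg (G u) (deg (G u) - 1)) (Function.update rem u 1) := by
  have hr : rem u = 0 := by omega
  have hu1 : 1 ≤ u := by
    by_contra hc
    have := h.rem_zero
    rw [show u = 0 by omega] at hr
    omega
  have hmem : u ∈ unmarked n rem := mem_unmarked.2 ⟨⟨hu1, hu⟩, hr⟩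
  have hv := h.bounds
  refine ⟨.inl ⟨by omega, hG.le u⟩, ?_, fun x => ?_, fun w => ?_, fun x hx hxr => ?_,
    fun x hx hxv hxn hxu => ?_⟩
  · rw [Function.update_of_ne (by omega), h.rem_zero]
  · by_cases hx : x = u
    · simp [hx]
    · simpa [hx] using h.rem_le x
  · rw [unmarked_update, Finset.filter_erase]
    by_cases hw : w = G u
    · subst hw
      rw [Function.update_self, h.deg_eq, Finset.card_erase_of_mem (by simp [hmem])]
    · rw [Function.update_of_ne hw, h.deg_eq, Finset.erase_eq_of_notMem]
      simp [Ne.symm hw]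
  · by_cases hxu : x = u
    · subst hxu
      intro hc
      -- A cyclic `x` has a cyclic predecessor, which is still unmarked and contradicts the zero
      -- count at `x`.
      obtain ⟨y, hy, hyx⟩ : ∃ y, Cyc G y ∧ G y = x := by
        obtain ⟨k, hk⟩ := hc.2
        refine ⟨G^[k] x, hc.of_leads hG.zero ⟨k, rfl⟩, ?_⟩
        rw [← Function.iterate_succ_apply' G, Function.iterate_succ_apply, hk]
      have hyb := hG.bounds_of_cyc hy
      have hyr : rem y = 0 := by
        by_contra hne
        exact h.not_cyc y (by omega) hne hy
      have hpos : 0 < {z ∈ unmarked n rem | G z = x}.card :=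
        Finset.card_pos.2 ⟨y, by simp [mem_unmarked, hyr, hyx]; omega⟩
      rw [← h.deg_eq] at hpos
      omega
    · rw [Function.update_of_ne hxu] at hxr
      exact h.not_cyc x hx hxr
  · by_cases hxu' : x = u
    · exact .inl (by simp [hxu'])
    · rw [Function.update_of_ne hxu', Function.update_of_ne hxu]
      exact h.inspected x hx hxv hxn hxu'

theorem PeelInv.next (h : PeelInv n G v u deg rem) (hu : u ≤ n) (hd : deg u + rem u ≠ 0) :
    PeelInv n G (v + 1) (v + 1) deg rem := by
  have hv := h.bounds
  refine ⟨by omega, h.rem_zero, h.rem_le, h.deg_eq, h.not_cyc, fun x hx hxv hxn hxu => ?_⟩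
  by_cases hxu' : x = u
  · subst hxu'
    omega
  · exact h.inspected x hx (by omega) hxn hxu'

/-- At the end, exactly the cyclic vertices are left. -/
theorem PeelInv.rem_eq_zero_iff (h : PeelInv n G v u deg rem) (hu : n < u)
    {x : ℕ} (h1 : 1 ≤ x) (hx : x ≤ n) : rem x = 0 ↔ Cyc G x := by
  refine ⟨fun hr => ?_, fun hc => by by_contra hne; exact h.not_cyc x h1 hne hc⟩
  -- Every unmarked vertex has an unmarked predecessor. By finiteness `G` permutes the unmarked set,
  -- so all its points are periodic.
  have hsub : unmarked n rem ⊆ (unmarked n rem).image G := by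
    intro y hy
    have hy' := mem_unmarked.1 hy
    have hb := h.bounds
    rcases h.inspected y hy'.1.1 (by omega) hy'.1.2 (by omega) with hc | hc
    · exact absurd hy'.2 hc
    · rw [h.deg_eq] at hc
      obtain ⟨z, hz⟩ := Finset.card_pos.1 (Nat.pos_of_ne_zero hc)
      rw [Finset.mem_filter] at hz
      exact Finset.mem_image.2 ⟨z, hz⟩
  have heq := Finset.eq_of_subset_of_card_le hsub Finset.card_image_le
  have hinj : Set.InjOn G (unmarked n rem) := Finset.card_image_iff.1 (by rw [← heq])
  have hmaps : Set.MapsTo G (unmarked n rem) (unmarked n rem) := fun y hy => by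
    have := Finset.mem_image_of_mem G (Finset.mem_coe.1 hy)
    rwa [← heq] at this
  have hxm : x ∈ unmarked n rem := mem_unmarked.2 ⟨⟨h1, hx⟩, hr⟩
  have hinj' : Function.Injective (hmaps.restrict G _ _) := hmaps.restrict_inj.2 hinj
  obtain ⟨k, hk, hper⟩ := hinj'.mem_periodicPts (⟨x, hxm⟩ : (unmarked n rem : Set ℕ))
  have hit : G^[k] x = x := by
    have := congrArg Subtype.val (hper.eq)
    rwa [hmaps.iterate_restrict] at this
  refine ⟨by omega, k - 1, ?_⟩
  rw [← Function.iterate_succ_apply, Nat.succ_eq_add_one, Nat.sub_add_cancel hk, hit]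

end Peel

/-! ### Finding the cycle maxima in decreasing order -/

section Scan

variable {n : ℕ} {G : ℕ → ℕ} {T B rem : ℕ → ℕ} {i u p : ℕ}

open Classical in
/-- The maxima of the cycles below `i` in decreasing order. -/
noncomputable def maximaBelow (G : ℕ → ℕ) (i : ℕ) : List ℕ :=
  ((List.range i).filter (IsMax G ·)).reverse

theorem maximaBelow_succ_of_isMax (h : IsMax G i) :
    maximaBelow G (i + 1) = i :: maximaBelow G i := by
  simp [maximaBelow, List.range_succ, h]

theorem maximaBelow_succ_of_not_isMax (h : ¬ IsMax G i) :
    maximaBelow G (i + 1) = maximaBelow G i := by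
  simp [maximaBelow, List.range_succ, h]

theorem Linked.isMaxList_maximaBelow (h : Linked n G p) : IsMaxList G (maximaBelow G p) := by
  constructor
  · rw [maximaBelow, List.pairwise_reverse]
    exact List.Pairwise.filter _ List.pairwise_lt_range
  · intro x
    simp only [maximaBelow, List.mem_reverse, List.mem_filter, List.mem_range, decide_eq_true_eq]
    exact ⟨fun hx => hx.2, fun hx => ⟨h.cyc_lt x hx.1, hx⟩⟩

/-- Invariant of the scan for maxima of cycles: the cycles with a vertex from `i` upwards are
marked, except for the part of a single cycle that starts in `u`. -/
structure ScanInv (n : ℕ) (G T : ℕ → ℕ) (i u p : ℕ) (rem B : ℕ → ℕ) : Prop where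
  le : i ≤ n
  u_le : u ≤ n
  rem_zero : rem 0 ≠ 0
  cyc : ∀ x, 1 ≤ x → x ≤ n → rem x = 0 → Cyc G x
  seen : ∀ x, Cyc G x → rem x ≠ 0 → ∃ y, i ≤ y ∧ Leads G x y
  current : rem u = 0 → ∃ y, i ≤ y ∧ Leads G u y
  closed : ∀ x, Cyc G x → rem x ≠ 0 → rem (G x) ≠ 0 ∨ G x = u
  above : ∀ x, Cyc G x → i ≤ x → rem x ≠ 0 ∨ x = u
  link : relink p (maximaBelow G i) B = T

theorem ScanInv.one_le (h : ScanInv n G T i u p rem B) (hu : rem u = 0) : 1 ≤ u := by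
  by_contra hc
  exact h.rem_zero ((show u = 0 by omega) ▸ hu)

theorem ScanInv.mark (hG : Rooted n G) (h : ScanInv n G T i u p rem B) (hu : rem u = 0) :
    ScanInv n G T i (G u) p (Function.update rem u 1) B := by
  have hu1 := h.one_le hu
  have hcyc := h.cyc u hu1 h.u_le hu
  obtain ⟨y, hy, huy⟩ := h.current hu
  have hmono : ∀ x, rem x ≠ 0 → Function.update rem u 1 x ≠ 0 := by
    intro x hx
    rw [Function.update_apply]
    split_ifs
    · exact one_ne_zero
    · exact hx
  have hself : Function.update rem u 1 u ≠ 0 := by simp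
  refine ⟨h.le, hG.le u, hmono 0 h.rem_zero, fun x h1 hx hr => ?_, fun x hx hr => ?_, fun _ => ?_,
    fun x hx hr => ?_, fun x hx hi => ?_, h.link⟩
  · refine h.cyc x h1 hx ?_
    by_contra hc
    exact hmono x hc hr
  · by_cases hxu : x = u
    · exact ⟨y, hy, hxu ▸ huy⟩
    · rw [Function.update_of_ne hxu] at hr
      exact h.seen x hx hr
  · refine ⟨y, hy, ?_⟩
    rcases huy.cases_head with rfl | huy
    · exact hcyc.2
    · exact huy
  · by_cases hxu : x = u
    · exact .inr (by rw [hxu])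
    · rw [Function.update_of_ne hxu] at hr
      rcases h.closed x hx hr with hc | hc
      · exact .inl (hmono _ hc)
      · exact .inl (hc ▸ hself)
  · rcases h.above x hx hi with hc | rfl
    · exact .inl (hmono _ hc)
    · exact .inl hself

/-- If `i` is marked, its cycle contains a vertex above `i`. If it is unmarked, a larger vertex of
its cycle would be marked; as `u` is marked too, `closed` would carry the mark around the cycle to
`i`. -/
theorem ScanInv.isMax_iff (hG : Rooted n G) (h : ScanInv n G T (i + 1) u p rem B)
    (hu : rem u ≠ 0) : IsMax G i ↔ rem i = 0 := by
  constructor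
  · intro hi
    by_contra hr
    obtain ⟨y, hy, hiy⟩ := h.seen i hi.1 hr
    have := hi.2 y hiy
    omega
  · intro hr
    have hi1 : 1 ≤ i := by
      by_contra hc
      exact h.rem_zero ((show i = 0 by omega) ▸ hr)
    have hc := h.cyc i hi1 (by have := h.le; omega) hr
    refine ⟨hc, fun y hy => ?_⟩
    by_contra hlt
    have hyc := hc.of_leads hG.zero hy
    have hyr : rem y ≠ 0 := by
      rcases h.above y hyc (by omega) with hc | rfl
      · exact hc
      · exact hu
    refine (hc.leads_symm hy).rec_tail (P := fun z => rem z ≠ 0) hyr (fun z hz hzr => ?_) hr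
    rcases h.closed z (hyc.of_leads hG.zero hz) hzr with hc | hc
    · exact hc
    · exact hc ▸ hu

/-- Once `u` is marked, the exceptions for `u` in the invariant are void, and `i` takes over as the
only exception. -/
theorem ScanInv.next (h : ScanInv n G T (i + 1) u p rem B) (hu : rem u ≠ 0) {q : ℕ} {B' : ℕ → ℕ}
    (hlink : relink q (maximaBelow G i) B' = T) : ScanInv n G T i i q rem B' := by
  have hle := h.le
  refine ⟨by omega, by omega, h.rem_zero, h.cyc, fun x hx hr => ?_,
    fun _ => ⟨i, le_rfl, .refl ..⟩, fun x hx hr => ?_, fun x hx hi => ?_, hlink⟩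
  · obtain ⟨y, hy, hxy⟩ := h.seen x hx hr
    exact ⟨y, by omega, hxy⟩
  · rcases h.closed x hx hr with hc | hc
    · exact .inl hc
    · exact .inl (hc ▸ hu)
  · rcases eq_or_lt_of_le hi with rfl | hi
    · exact .inr rfl
    · rcases h.above x hx hi with hc | rfl
      · exact .inl hc
      · exact .inl hu

theorem ScanInv.skip (hG : Rooted n G) (h : ScanInv n G T (i + 1) u p rem B) (hu : rem u ≠ 0)
    (hi : rem i ≠ 0) : ScanInv n G T i i p rem B :=
  h.next hu (by
    rw [← h.link, maximaBelow_succ_of_not_isMax fun hm => hi ((h.isMax_iff hG hu).1 hm)])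

theorem ScanInv.splice (hG : Rooted n G) (h : ScanInv n G T (i + 1) u p rem B) (hu : rem u ≠ 0)
    (hi : rem i = 0) : ScanInv n G T i i i rem (splice B p i) :=
  h.next hu (by rw [← h.link, maximaBelow_succ_of_isMax ((h.isMax_iff hG hu).2 hi), relink])

theorem ScanInv.start (h : Linked n G n) (h0 : rem 0 ≠ 0)
    (hr : ∀ x, 1 ≤ x → x ≤ n → (rem x = 0 ↔ Cyc G x)) :
    ScanInv n G (relink n (maximaBelow G n) G) n n n rem G := by
  have hne : ∀ x, Cyc G x → rem x = 0 := fun x hx => by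
    have hb := h.bounds_of_cyc hx
    exact (hr x hb.1.le hb.2).2 hx
  exact ⟨le_rfl, le_rfl, h0, fun x h1 hx => (hr x h1 hx).1, fun x hx hc => absurd (hne x hx) hc,
    fun _ => ⟨n, le_rfl, .refl ..⟩, fun x hx hc => absurd (hne x hx) hc,
    fun x hx hi => absurd (h.cyc_lt x hx) (by omega), rfl⟩

theorem ScanInv.eq (h : ScanInv n G T 0 u p rem B) : B = T := h.link

end Scan

/-! ### Undoing the merging steps along the path -/

section Back

variable {n : ℕ} {G T : ℕ → ℕ} {K j p : ℕ}

/-- The path from `n` to the root has `K` edges. -/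
structure PathLength (n : ℕ) (T : ℕ → ℕ) (K : ℕ) : Prop where
  eq : T^[K] n = 1
  le : ∀ k, T^[k] n = 1 → K ≤ k

theorem PathLength.exists (h : Leads T n 1) : ∃ K, PathLength n T K := by
  classical
  exact ⟨Nat.find h, Nat.find_spec h, fun k hk => Nat.find_min' h hk⟩

/-- A repeated vertex would give a shortcut to `1`, against the minimality of `K`. -/
theorem PathLength.injOn (h : PathLength n T K) : Set.InjOn (fun i => T^[i] n) (Set.Iic K) := by
  intro a ha b hb hab
  wlog hlt : a < b generalizing a b
  · by_contra hne
    exact hne (this hb ha hab.symm (by omega)).symm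
  have ha' : a ≤ K := ha
  have hb' : b ≤ K := hb
  change T^[a] n = T^[b] n at hab
  have : T^[K - b + a] n = 1 := by
    rw [Function.iterate_add_apply, hab, ← Function.iterate_add_apply, Nat.sub_add_cancel hb', h.eq]
  have := h.le _ this
  omega

theorem PathLength.length_le (hT : Rooted n T) (h : PathLength n T K) : K ≤ n := by
  have hmem : ∀ i ∈ Finset.range (K + 1), T^[i] n ∈ Finset.range (n + 1) := by
    rintro (_ | i) -
    · simp
    · rw [Function.iterate_succ_apply', Finset.mem_range]
      have := hT.le (T^[i] n)
      omega
  have hinj : Set.InjOn (fun i => T^[i] n) (Finset.range (K + 1)) :=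
    h.injOn.mono fun i hi => by
      have := Finset.mem_range.1 (Finset.mem_coe.1 hi)
      exact Nat.lt_succ_iff.1 this
  have := Finset.card_le_card_of_injOn _ hmem hinj
  simp only [Finset.card_range] at this
  omega

theorem PathLength.pos (hn : 2 ≤ n) (h : PathLength n T K) : 0 < K := by
  rcases Nat.eq_zero_or_pos K with rfl | hK
  · have : n = 1 := h.eq
    omega
  · exact hK

theorem PathLength.linked (hn : 2 ≤ n) (hT : Rooted n T) (hc : ∀ x, ¬ Cyc T x)
    (h : PathLength n T K) : Linked n T (T^[K - 1] n) := by
  have hpos := h.pos hn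
  have hlast : T (T^[K - 1] n) = 1 := by
    rw [← Function.iterate_succ_apply' T, Nat.succ_eq_add_one, Nat.sub_add_cancel hpos, h.eq]
  refine ⟨hT, ?_, hlast, ⟨_, rfl⟩, fun x hx => absurd hx (hc x)⟩
  by_contra hlt
  have := hT.out _ fun hh => hlt hh.1
  omega

/-- Invariant of the backward pass over the path from `n` to the root, which undoes the merging
steps; the pass has arrived at the vertex number `j` of the path. -/
structure BackInv (n : ℕ) (T : ℕ → ℕ) (K j p : ℕ) (G : ℕ → ℕ) : Prop where
  linked : Linked n G p
  steps : Relation.ReflTransGen (MergeStep n) (G, p) (T, T^[K - 1] n)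
  kept : ∃ a, j ≤ a ∧ a < K ∧ p = T^[a] n ∧ (∀ i ≤ a, G^[i] n = T^[i] n) ∧
    ∀ i, j ≤ i → i ≤ a → T^[i] n ≤ p

theorem BackInv.start (hn : 2 ≤ n) (hT : Rooted n T) (hc : ∀ x, ¬ Cyc T x)
    (h : PathLength n T K) : BackInv n T K (K - 1) (T^[K - 1] n) T :=
  ⟨h.linked hn hT hc, .refl, K - 1, le_rfl, by have := h.pos hn; omega, rfl, fun _ _ => rfl,
    fun i h1 h2 => by rw [le_antisymm h1 h2]⟩

theorem BackInv.skip (h : BackInv n T K (j + 1) p G) (hp : T^[j] n ≤ p) : BackInv n T K j p G := by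
  obtain ⟨a, hja, haK, hpa, hpre, hle⟩ := h.kept
  refine ⟨h.linked, h.steps, a, by omega, haK, hpa, hpre, fun i h1 h2 => ?_⟩
  rcases eq_or_lt_of_le h1 with rfl | h1
  · exact hp
  · exact hle i h1 h2

/-- The vertices of the path after number `j` are at most `p`, and vertex number `j` exceeds `p`:
this is the situation of `Linked.unmerge`. The part of the path up to number `j` is kept, since the
splice changes only vertices number `j` and `a`. -/
theorem BackInv.splice (hK : PathLength n T K) (h : BackInv n T K (j + 1) p G)
    (hp : p < T^[j] n) : BackInv n T K j (T^[j] n) (splice G p (T^[j] n)) := by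
  obtain ⟨a, hja, haK, hpa, hpre, hle⟩ := h.kept
  have hL := h.linked
  have hpu : Leads G (T^[j] n) p := by
    refine ⟨a - j, ?_⟩
    rw [← hpre j (by omega), ← Function.iterate_add_apply, Nat.sub_add_cancel (by omega),
      hpre a le_rfl, hpa]
  have hbelow : ∀ x, Leads G (G (T^[j] n)) x → x ≤ p := by
    intro x hx
    have h1 := hL.one_lt
    suffices (∃ i, j + 1 ≤ i ∧ i ≤ a ∧ x = T^[i] n) ∨ x = 1 ∨ x = 0 by
      rcases this with ⟨i, hi, hia, rfl⟩ | hx | hx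
      · exact hle i hi hia
      · omega
      · omega
    refine hx.rec_tail (P := fun x => (∃ i, j + 1 ≤ i ∧ i ≤ a ∧ x = T^[i] n) ∨ x = 1 ∨ x = 0)
      ?_ ?_
    · refine .inl ⟨j + 1, le_rfl, hja, ?_⟩
      rw [← hpre (j + 1) hja, Function.iterate_succ_apply', hpre j (by omega)]
    · rintro y - (⟨i, hi, hia, rfl⟩ | rfl | rfl)
      · rcases eq_or_lt_of_le hia with rfl | hia
        · exact .inr (.inl (hpa ▸ hL.last))
        · refine .inl ⟨i + 1, by omega, hia, ?_⟩
          rw [← hpre (i + 1) hia, Function.iterate_succ_apply', hpre i (by omega)]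
      · exact .inr (.inr hL.one)
      · exact .inr (.inr hL.zero)
  have hM := hL.unmerge ⟨j, hpre j (by omega)⟩ hpu hp hbelow
  refine ⟨hM.linked, h.steps.head ⟨hM, (splice_splice hp.ne hL.last).symm⟩, j, le_rfl, by omega,
    rfl, fun i hi => ?_, fun i h1 h2 => by rw [le_antisymm h1 h2]⟩
  induction i with
  | zero => rfl
  | succ i ih =>
    have hne : ∀ b, b ≤ K → i < b → T^[i] n ≠ T^[b] n := fun b hb hib heq => by
      have := hK.injOn (Set.mem_Iic.2 (by omega)) (Set.mem_Iic.2 hb) heq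
      omega
    rw [Function.iterate_succ_apply', ih (by omega),
      splice_of_ne (hpa ▸ hne a (by omega) (by omega)) (hne j (by omega) (by omega)),
      ← hpre i (by omega), ← Function.iterate_succ_apply' G, hpre (i + 1) (by omega)]

theorem BackInv.eq (h : BackInv n T K 0 p G) : p = n := by
  obtain ⟨a, -, -, -, -, hle⟩ := h.kept
  exact le_antisymm h.linked.le_n (hle 0 le_rfl (Nat.zero_le a))

theorem BackInv.exists_fn (hn : 2 ≤ n) (hc : ∀ x, ¬ Cyc T x) (h : BackInv n T K 0 p G) :
    ∃ f : Fn n, table f = Function.update G n 0 ∧ theta f = graphOf n T := by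
  obtain rfl := h.eq
  have hL := h.linked
  obtain ⟨f, hf⟩ := exists_table (n := p) (A := Function.update G p 0)
    (fun x hx => by
      by_cases hxp : x = p
      · simp [hxp]
      · rw [Function.update_of_ne hxp]
        exact hL.out x fun hh => hx ⟨hh.1, lt_of_le_of_ne hh.2 hxp⟩)
    (fun x hx => by
      rw [Function.update_of_ne hx.2.ne]
      exact hL.pos x hx.1 hx.2.le)
    (fun x => by
      rw [Function.update_apply]
      split_ifs
      · exact Nat.zero_le p
      · exact hL.le x)
  have hr : rootedTable f = G := by
    rw [rootedTable, hf, Function.update_idem, ← hL.last, Function.update_eq_self]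
  have hms := isMaxList_cycleMaxima (f := f) hn
  refine ⟨f, hf, ?_⟩
  rw [theta_eq_graphOf hn hms]
  rw [hr] at hms ⊢
  rw [MergeStep.relink_eq h.steps hc hms]

end Back

end Cayley

/-! ### Reading and writing edge lists -/

namespace RAM

open Cayley

infixr:60 " ;; " => Program.seq

/-- Write the list of edges in the arrays `0` and `1` into the table in array `2`. -/
def loadTable : Program :=
  (.assign 1 (.const 0) ;; .assign 3 (.const 1) ;; .assign 4 (.const 0) ;; .assign 5 (.load 0 1)) ;;
  .while (.ne 5 4)
    (.assign 6 (.load 1 1) ;; .store 2 5 6 ;; .assign 1 (.add 1 3) ;; .assign 5 (.load 0 1))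

theorem run_loadTable {n W : ℕ} (hn : 1 ≤ n) (hW : n + 1 ≤ W) {A : ℕ → ℕ} (le : ∀ x, A x ≤ n)
    (out : ∀ x, A x ≠ 0 → 1 ≤ x ∧ x ≤ n) {L : List (Vertex n × Vertex n)}
    (hL : IsEdgeList (graphOf n A) L) :
    Run W loadTable (input n L) (10 * n)
      (fun s => s.reg 0 = n ∧ s.arr 2 = A ∧ ∀ a, 3 ≤ a → s.arr a = fun _ => 0) := by
  have hadj : ∀ e ∈ L, A e.1 = e.2 := fun e he => (hL.2 e.1 e.2).1 he
  have hlen : L.length ≤ n := by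
    have hnd : (L.map Prod.fst).Nodup := hL.1.map_on fun e he e' he' h =>
      Prod.ext h (Subtype.ext (by rw [← hadj e he, ← hadj e' he', h]))
    simpa using hnd.length_le_card
  have h0 : ∀ k (h : k < L.length), (input n L).arr 0 k = L[k].1 := fun k h => by
    simp [input, h]
  have h1 : ∀ k (h : k < L.length), (input n L).arr 1 k = L[k].2 := fun k h => by
    simp [input, h]
  -- Vertices are positive and cells past the input are `0`, so reading `0` signals the end of the
  -- list.
  have h0' : ∀ k, (input n L).arr 0 k ≠ 0 → k < L.length := fun k h => by
    by_contra hc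
    simp [input, hc] at h
  have hle0 : ∀ k, (input n L).arr 0 k ≤ n := fun k => by
    by_cases h : k < L.length
    · rw [h0 k h]; exact L[k].1.2.2
    · by_contra hc
      exact h (h0' k (by omega))
  have hle1 : ∀ k, k < L.length → (input n L).arr 1 k ≤ n := fun k h => by
    rw [h1 k h]; exact L[k].2.2.2
  let I : State → Prop := fun s => s.reg 0 = n ∧ s.reg 3 = 1 ∧ s.reg 4 = 0 ∧
    s.arr 0 = (input n L).arr 0 ∧ s.arr 1 = (input n L).arr 1 ∧ s.reg 1 ≤ L.length ∧
    s.reg 5 = (input n L).arr 0 (s.reg 1) ∧ (∀ x, s.arr 2 x = 0 ∨ s.arr 2 x = A x) ∧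
    (∀ j (h : j < L.length), j < s.reg 1 → s.arr 2 L[j].1 = A L[j].1) ∧
    ∀ a, 3 ≤ a → s.arr a = fun _ => 0
  refine Run.seq_while I (fun s => L.length - s.reg 1) n ?_ ?_ ?_ ?_ ?_
  · have := hle0 0
    simp [wp, Op.eval, I]
    refine ⟨by omega, by omega, rfl, fun x => .inl rfl, fun a ha => ?_⟩
    funext k
    match a, ha with
    | a + 3, _ => rfl
  · rintro s ⟨i0, i3, i4, a0, a1, i1, i5, h2, hj, ha⟩ hb
    simp only [Test.Holds, i4, i5] at hb
    have hk := h0' _ hb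
    have hs5 : s.reg 5 = L[s.reg 1].1 := by rw [i5, h0 _ hk]
    have hs6 : s.arr 1 (s.reg 1) = L[s.reg 1].2 := by rw [a1, h1 _ hk]
    have hA := hadj _ (L.getElem_mem hk)
    have hb1 := hle1 _ hk
    have hb2 := hle0 (s.reg 1 + 1)
    have hup : ∀ x : ℕ, x = L[s.reg 1].1 ∨ s.arr 2 x = A x →
        Function.update (s.arr 2) L[s.reg 1].1 L[s.reg 1].2 x = A x := by
      intro x hx
      rw [Function.update_apply]
      split_ifs with h
      · rw [h, hA]
      · exact hx.resolve_left h
    simp [wp, Op.eval, I, i0, i3, i4, a0, a1, hs5, hs6] at hb1 ⊢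
    rw [h1 _ hk] at hb1
    refine ⟨by omega, by omega, by omega, ⟨by omega, fun x => ?_, fun j h hlt => ?_,
      fun a h => ?_⟩, by omega⟩
    · rcases h2 x with h | h
      · by_cases hx : x = L[s.reg 1].1
        · exact .inr (hup x (.inl hx))
        · rw [Function.update_of_ne hx]; exact .inl h
      · exact .inr (hup x (.inr h))
    · rcases Nat.lt_or_eq_of_le hlt with hlt | rfl
      · exact hup _ (.inr (hj j h hlt))
      · exact hup _ (.inl rfl)
    · rw [if_neg (by omega), ha a h]
  · rintro s -
    omega
  · rintro s ⟨i0, i3, i4, a0, a1, i1, i5, h2, hj, ha⟩ hb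
    refine ⟨i0, ?_, ha⟩
    simp only [Test.Holds, i4, i5, not_not] at hb
    have hk : s.reg 1 = L.length := by
      by_contra hc
      have hlt : s.reg 1 < L.length := by omega
      have := L[s.reg 1].1.2.1
      rw [h0 _ hlt] at hb
      omega
    funext x
    rcases h2 x with h | h
    · rw [h]
      by_contra hne
      have hx := out x (Ne.symm hne)
      have he := (hL.2 ⟨x, hx⟩ ⟨A x, Nat.pos_of_ne_zero (Ne.symm hne), le x⟩).2 rfl
      obtain ⟨j, hjl, hje⟩ := List.getElem_of_mem he
      have := hj j hjl (by omega)
      rw [hje] at this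
      exact hne (h.symm.trans this)
    · exact h
  · simp only [cost]
    omega

end RAM

namespace RAM

open Cayley

/-- The edges `⟨x, A x⟩`, `x < i`, with `A x ≠ 0`. -/
def entries (A : ℕ → ℕ) (i : ℕ) : List (ℕ × ℕ) :=
  ((List.range i).filter (A · ≠ 0)).map fun x => (x, A x)

theorem length_entries_le (A : ℕ → ℕ) (i : ℕ) : (entries A i).length ≤ i := by
  rw [entries, List.length_map]
  exact (List.length_filter_le ..).trans List.length_range.le

theorem entries_succ_of_ne {A : ℕ → ℕ} {i : ℕ} (h : A i ≠ 0) :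
    entries A (i + 1) = entries A i ++ [(i, A i)] := by
  simp [entries, List.range_succ, h]

theorem entries_succ_of_eq {A : ℕ → ℕ} {i : ℕ} (h : A i = 0) :
    entries A (i + 1) = entries A i := by
  simp [entries, List.range_succ, h]

theorem mem_entries {A : ℕ → ℕ} {i x y : ℕ} :
    (x, y) ∈ entries A i ↔ x < i ∧ A x ≠ 0 ∧ A x = y := by
  simp only [entries, List.mem_map, List.mem_filter, List.mem_range, Prod.mk.injEq,
    decide_eq_true_eq]
  constructor
  · rintro ⟨z, ⟨h1, h2⟩, rfl, rfl⟩
    exact ⟨h1, h2, rfl⟩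
  · rintro ⟨h1, h2, rfl⟩
    exact ⟨x, ⟨h1, h2⟩, rfl, rfl⟩

/-- The entries of a table are the sorted list of the edges of its digraph. -/
theorem exists_isTable {n : ℕ} {A : ℕ → ℕ} (h0 : A 0 = 0) (le : ∀ x, A x ≤ n) :
    ∃ L : List (Vertex n × Vertex n), IsTable (graphOf n A) L ∧
      L.map (fun e => ((e.1 : ℕ), (e.2 : ℕ))) = entries A (n + 1) := by
  have hmem : ∀ e ∈ entries A (n + 1), e.1 ∈ Set.Icc 1 n ∧ e.2 ∈ Set.Icc 1 n := by
    rintro ⟨x, y⟩ he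
    obtain ⟨h1, h2, rfl⟩ := mem_entries.1 he
    refine ⟨⟨?_, by omega⟩, ⟨by omega, le x⟩⟩
    by_contra hx
    exact h2 ((show x = 0 by omega) ▸ h0)
  obtain ⟨L, hL⟩ : ∃ L : List (Vertex n × Vertex n),
      L.map (fun e => ((e.1 : ℕ), (e.2 : ℕ))) = entries A (n + 1) :=
    ⟨(entries A (n + 1)).pmap (fun e h => (⟨e.1, h.1⟩, ⟨e.2, h.2⟩)) hmem, by simp [List.map_pmap]⟩
  have hsort : L.Pairwise fun e e' => e.1 < e'.1 := by
    have : (L.map fun e => ((e.1 : ℕ), (e.2 : ℕ))).Pairwise fun e e' => e.1 < e'.1 := by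
      rw [hL, entries, List.pairwise_map]
      exact List.Pairwise.filter _ List.pairwise_lt_range
    rwa [List.pairwise_map] at this
  refine ⟨L, ⟨⟨hsort.imp fun h => ?_, fun i j => ?_⟩, hsort⟩, hL⟩
  · rintro rfl
    exact lt_irrefl _ h
  · have hinj : Function.Injective fun e : Vertex n × Vertex n => ((e.1 : ℕ), (e.2 : ℕ)) := by
      rintro ⟨a, b⟩ ⟨c, d⟩ h
      rw [Prod.mk.injEq] at h
      exact Prod.ext (Subtype.ext h.1) (Subtype.ext h.2)
    rw [← List.mem_map_of_injective hinj, hL, mem_entries]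
    refine ⟨fun h => h.2.2, fun h => ⟨Nat.lt_succ_of_le i.2.2, ?_, h⟩⟩
    have hA : A i = j := h
    rw [hA]
    exact Nat.one_le_iff_ne_zero.1 j.2.1

/-- Write the edges of the table in array `a` into the arrays `0` and `1`. -/
def emitTable (a : ℕ) : Program :=
  (.assign 1 (.const 1) ;; .assign 2 (.const 0) ;; .assign 3 (.const 1) ;; .assign 4 (.const 0)) ;;
  .while (.le 1 0)
    (.assign 5 (.load a 1) ;;
      .ite (.ne 5 4) (.store 0 2 1 ;; .store 1 2 5 ;; .assign 2 (.add 2 3)) .skip ;;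
      .assign 1 (.add 1 3))

theorem run_emitTable {n W a : ℕ} (hn : 1 ≤ n) (hW : n + 1 ≤ W) (ha : 2 ≤ a) {A : ℕ → ℕ}
    (h0 : A 0 = 0) (le : ∀ x, A x ≤ n) {s : State} (hs : s.reg 0 = n) (hA : s.arr a = A) :
    Run W (emitTable a) s (13 * n)
      (fun s => ∃ L, IsTable (graphOf n A) L ∧ s.Stores n L) := by
  let I : State → Prop := fun s => s.reg 0 = n ∧ s.reg 3 = 1 ∧ s.reg 4 = 0 ∧ s.arr a = A ∧
    1 ≤ s.reg 1 ∧ s.reg 1 ≤ n + 1 ∧ s.reg 2 = (entries A (s.reg 1)).length ∧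
    ∀ j x y, (entries A (s.reg 1))[j]? = some (x, y) → s.arr 0 j = x ∧ s.arr 1 j = y
  have ha0 : a ≠ 0 := by omega
  have ha1 : a ≠ 1 := by omega
  refine Run.seq_while I (fun s => n + 1 - s.reg 1) n ?_ ?_ ?_ ?_ ?_
  · simp [wp, Op.eval, I, hs, hA]
    refine ⟨by omega, ?_⟩
    simp [entries, h0]
  · rintro s ⟨i0, i3, i4, iA, i1, i1', i2, hj⟩ hb
    simp only [Test.Holds, i0] at hb
    have hlen := length_entries_le A (s.reg 1)
    have hle := le (s.reg 1)
    simp [wp, Op.eval, Test.Holds, I, i0, i3, i4, iA, i2, ha0, ha1]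
    refine ⟨by omega, fun hne => ⟨by omega, by omega, ⟨by omega, ?_, ?_⟩, by omega⟩,
      fun hz => ⟨by omega, ⟨by omega, ?_, ?_⟩, by omega⟩⟩
    · rw [entries_succ_of_ne hne, List.length_append, List.length_singleton]
    · intro j x y h
      rw [entries_succ_of_ne hne, List.getElem?_append] at h
      split_ifs at h with hlt
      · rw [Function.update_of_ne hlt.ne, Function.update_of_ne hlt.ne]
        exact hj j x y h
      · rw [List.getElem?_singleton] at h
        split_ifs at h with heq
        obtain rfl : j = (entries A (s.reg 1)).length := by omega
        simpa using h
    · rw [entries_succ_of_eq hz]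
    · rw [entries_succ_of_eq hz]
      exact hj
  · rintro s ⟨-, -, -, -, i1, -⟩
    omega
  · rintro s ⟨i0, -, -, -, -, i1, -, hj⟩ hb
    simp only [Test.Holds, i0] at hb
    obtain ⟨L, hL, hLe⟩ := exists_isTable h0 le
    refine ⟨L, hL, i0, fun k hk => hj k _ _ ?_⟩
    rw [show s.reg 1 = n + 1 by omega, ← hLe, List.getElem?_map, List.getElem?_eq_getElem hk]
    rfl
  · simp [cost]
    omega

end RAM

/-! ### The program for Θ -/

namespace RAM

open Cayley

/-- Add the edge from `n` to `1` to the table in array `2`, copy the table to array `3`, and write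
the numbers of incoming edges to array `4`. -/
def countEdges : Program :=
  (.assign 1 (.const 1) ;; .assign 3 (.const 1) ;; .store 2 0 3) ;;
  .while (.le 1 0)
    (.assign 2 (.load 2 1) ;; .store 3 1 2 ;; .assign 5 (.load 4 2) ;; .assign 5 (.add 5 3) ;;
      .store 4 2 5 ;; .assign 1 (.add 1 3))

theorem run_countEdges {n W : ℕ} (hn : 2 ≤ n) (hW : n + 1 ≤ W) {f : Fn n} {s : State}
    (hs : s.reg 0 = n) (h2 : s.arr 2 = table f) (ha : ∀ a, 3 ≤ a → s.arr a = fun _ => 0) :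
    Run W countEdges s (9 * n) (fun s => s.reg 0 = n ∧ s.arr 2 = rootedTable f ∧
      s.arr 3 = rootedTable f ∧ s.arr 5 = (fun _ => 0) ∧
      ∀ w, s.arr 4 w = {x ∈ Finset.Icc 1 n | rootedTable f x = w}.card) := by
  have hL := linked_rootedTable (f := f) hn
  let I : State → Prop := fun s => s.reg 0 = n ∧ s.reg 3 = 1 ∧ s.arr 2 = rootedTable f ∧
    1 ≤ s.reg 1 ∧ s.reg 1 ≤ n + 1 ∧ (∀ x, x < s.reg 1 → s.arr 3 x = rootedTable f x) ∧
    (∀ x, s.reg 1 ≤ x → s.arr 3 x = 0) ∧ s.arr 5 = (fun _ => 0) ∧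
    ∀ w, s.arr 4 w = {x ∈ Finset.Ico 1 (s.reg 1) | rootedTable f x = w}.card
  refine Run.seq_while I (fun s => n + 1 - s.reg 1) n ?_ ?_ ?_ ?_ ?_
  · simp [wp, Op.eval, I, hs, h2, ha]
    exact ⟨by omega, rfl, hL.zero.symm⟩
  · rintro s ⟨i0, i3, a2, i1, i1', h3, h3', a5, h4⟩ hb
    simp only [Test.Holds, i0] at hb
    have hle := hL.le (s.reg 1)
    have hcard : s.arr 4 (rootedTable f (s.reg 1)) ≤ n := by
      rw [h4]
      refine (Finset.card_filter_le ..).trans ?_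
      rw [Nat.card_Ico]
      omega
    simp [wp, Op.eval, I, i0, i3, a2, a5]
    refine ⟨by omega, by omega, by omega, by omega, ⟨by omega, fun x hx => ?_, fun x hx => ?_,
      fun w => ?_⟩, by omega⟩
    · rw [Function.update_apply]
      split_ifs with h
      · rw [h]
      · exact h3 x (by omega)
    · rw [Function.update_of_ne (by omega)]
      exact h3' x (by omega)
    · have hins : Finset.Ico 1 (s.reg 1 + 1) = insert (s.reg 1) (Finset.Ico 1 (s.reg 1)) := by
        ext y
        simp only [Finset.mem_Ico, Finset.mem_insert]
        omega
      rw [hins, Finset.filter_insert, Function.update_apply]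
      by_cases hw : w = rootedTable f (s.reg 1)
      · rw [if_pos hw, if_pos hw.symm, Finset.card_insert_of_notMem (by simp), ← hw, h4]
      · rw [if_neg hw, if_neg (Ne.symm hw), h4]
  · rintro s ⟨-, -, -, i1, -⟩
    omega
  · rintro s ⟨i0, i3, a2, i1, i1', h3, h3', a5, h4⟩ hb
    simp only [Test.Holds, i0] at hb
    refine ⟨i0, a2, ?_, a5, ?_⟩
    · funext x
      by_cases hx : x < s.reg 1
      · exact h3 x hx
      · rw [h3' x (by omega), hL.out x (by omega)]
    · rw [show s.reg 1 = n + 1 by omega] at h4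
      exact h4
  · simp [cost]
    omega

/-- Mark in array `5` the vertices that are not on cycles. -/
def peel : Program :=
  (.assign 1 (.const 1) ;; .assign 2 (.const 1) ;; .assign 3 (.const 1) ;; .assign 4 (.const 0) ;;
    .store 5 4 3) ;;
  .while (.le 2 0)
    (.assign 5 (.load 4 2) ;; .assign 6 (.load 5 2) ;; .assign 5 (.add 5 6) ;;
      .ite (.eq 5 4)
        (.store 5 2 3 ;; .assign 2 (.load 2 2) ;; .assign 5 (.load 4 2) ;; .assign 5 (.sub 5 3) ;;
          .store 4 2 5)
        (.assign 1 (.add 1 3) ;; .assign 2 (.copy 1)))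

theorem run_peel {n W : ℕ} (hn : 2 ≤ n) (hW : n + 1 ≤ W) {G : ℕ → ℕ} (hG : Rooted n G) {s : State}
    (hs : s.reg 0 = n) (h2 : s.arr 2 = G) (h3 : s.arr 3 = G) (h5 : s.arr 5 = fun _ => 0)
    (h4 : ∀ w, s.arr 4 w = {x ∈ Finset.Icc 1 n | G x = w}.card) :
    Run W peel s (30 * n) (fun s => s.reg 0 = n ∧ s.arr 2 = G ∧ s.arr 3 = G ∧ s.arr 5 0 ≠ 0 ∧
      (∀ x, s.arr 5 x ≤ 1) ∧ ∀ x, 1 ≤ x → x ≤ n → (s.arr 5 x = 0 ↔ Cyc G x)) := by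
  let I : State → Prop := fun s => s.reg 0 = n ∧ s.reg 3 = 1 ∧ s.reg 4 = 0 ∧ s.arr 2 = G ∧
    s.arr 3 = G ∧ PeelInv n G (s.reg 1) (s.reg 2) (s.arr 4) (s.arr 5)
  -- Each round marks a vertex or advances the inspection counter.
  refine Run.seq_while I (fun s => (n + 1 - s.reg 1) + (unmarked n (s.arr 5)).card) (2 * n + 1)
    ?_ ?_ ?_ ?_ ?_
  · simp [wp, Op.eval, I, hs, h2, h3, h5]
    refine ⟨by omega, .inl ⟨by omega, by omega⟩, by simp, fun x => ?_, fun w => ?_, fun x hx hr => ?_,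
      fun x hx hxv _ hne => absurd (le_antisymm hxv hx) hne⟩
    · rw [Function.update_apply]
      split_ifs <;> omega
    · rw [h4]
      congr 2
      ext x
      rw [mem_unmarked, Finset.mem_Icc]
      refine ⟨fun h => ⟨h, ?_⟩, fun h => h.1⟩
      rw [Function.update_of_ne (by omega)]
    · rw [Function.update_of_ne (by omega)] at hr
      exact absurd rfl hr
  · rintro s ⟨i0, i3, i4, a2, a3, hI⟩ hb
    simp only [Test.Holds, i0] at hb
    have hd := hI.deg_le (s.reg 2)
    have hd' := hI.deg_le (G (s.reg 2))
    have hr := hI.rem_le (s.reg 2)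
    have hle := hG.le (s.reg 2)
    have hbd := hI.bounds
    simp only [wp, Op.eval, Test.Holds, I, State.setReg_reg, State.setReg_arr, State.setArr_reg,
      State.setArr_arr, i0, i3, i4, a2, a3, reduceIte, Nat.reduceEqDiff]
    refine ⟨by omega, by omega, by omega, fun hz => ?_, fun hz => ?_⟩
    · have hr0 : s.arr 5 (s.reg 2) = 0 := by omega
      have h1 : 1 ≤ s.reg 2 := by
        by_contra hc
        have := hI.rem_zero
        rw [show s.reg 2 = 0 by omega] at hr0
        omega
      simp
      have := card_unmarked_update_lt h1 hb hr0
      exact ⟨by omega, by omega, by omega, hI.remove hG hb hz, by omega⟩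
    · simp
      exact ⟨by omega, hI.next hb hz, by omega⟩
  · rintro s ⟨-, -, -, -, -, hI⟩
    have := card_unmarked_le (n := n) (rem := s.arr 5)
    omega
  · rintro s ⟨i0, i3, i4, a2, a3, hI⟩ hb
    simp only [Test.Holds, i0] at hb
    refine ⟨i0, a2, a3, ?_, hI.rem_le, fun x h1 hx => hI.rem_eq_zero_iff (by omega) h1 hx⟩
    rw [hI.rem_zero]
    exact one_ne_zero
  · simp [cost]
    omega

/-- Find the maxima of the cycles from the largest one downwards, and merge their cycles in array
`3` into the path that starts in `n`. -/
def mergeCycles : Program :=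
  (.assign 1 (.copy 0) ;; .assign 2 (.copy 0) ;; .assign 7 (.copy 0) ;; .assign 3 (.const 1) ;;
    .assign 4 (.const 0)) ;;
  .while (.ne 1 4)
    (.assign 5 (.load 5 2) ;;
      .ite (.eq 5 4)
        (.store 5 2 3 ;; .assign 2 (.load 2 2))
        (.assign 1 (.sub 1 3) ;; .assign 2 (.copy 1) ;; .assign 5 (.load 5 1) ;;
          .ite (.eq 5 4)
            (.assign 6 (.load 3 1) ;; .store 3 7 6 ;; .store 3 1 3 ;; .assign 7 (.copy 1))
            .skip))

theorem run_mergeCycles {n W : ℕ} (hW : n + 1 ≤ W) {G : ℕ → ℕ} (hG : Linked n G n) {s : State}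
    (hs : s.reg 0 = n) (h2 : s.arr 2 = G) (h3 : s.arr 3 = G) (h50 : s.arr 5 0 ≠ 0)
    (h51 : ∀ x, s.arr 5 x ≤ 1)
    (h5 : ∀ x, 1 ≤ x → x ≤ n → (s.arr 5 x = 0 ↔ Cyc G x)) :
    Run W mergeCycles s (30 * n)
      (fun s => s.reg 0 = n ∧ s.arr 3 = relink n (maximaBelow G n) G) := by
  let T := relink n (maximaBelow G n) G
  let I : State → Prop := fun s => s.reg 0 = n ∧ s.reg 3 = 1 ∧ s.reg 4 = 0 ∧ s.arr 2 = G ∧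
    (∀ x, s.arr 5 x ≤ 1) ∧ (∀ x, s.arr 3 x ≤ n) ∧
    ScanInv n G T (s.reg 1) (s.reg 2) (s.reg 7) (s.arr 5) (s.arr 3)
  -- Each round marks a vertex or lowers the scan position. Array `2` keeps the original map, so a
  -- cycle can still be followed after it was cut open in array `3`.
  refine Run.seq_while I (fun s => s.reg 1 + (unmarked n (s.arr 5)).card) (2 * n) ?_ ?_ ?_ ?_ ?_
  · simp [wp, Op.eval, I, hs, h2, h3]
    exact ⟨by omega, by omega, h51, hG.le, .start hG h50 h5⟩
  · rintro s ⟨i0, i3, i4, a2, h51, h3, hI⟩ hb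
    simp only [Test.Holds, i4] at hb
    have hr := h51 (s.reg 2)
    have hr' := h51 (s.reg 1 - 1)
    have h3' := h3 (s.reg 1 - 1)
    have hle := hG.le (s.reg 2)
    have hi := hI.le
    simp only [wp, Op.eval, Test.Holds, I, State.setReg_reg, State.setReg_arr, State.setArr_reg,
      State.setArr_arr, i0, i3, i4, a2, reduceIte, Nat.reduceEqDiff]
    refine ⟨by omega, fun hz => ?_, fun hz => ?_⟩
    · simp
      have := card_unmarked_update_lt (hI.one_le hz) hI.u_le hz
      refine ⟨by omega, ⟨fun x => ?_, h3, hI.mark hG.toRooted hz⟩, by omega⟩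
      rw [Function.update_apply]
      split_ifs
      · exact le_rfl
      · exact h51 x
    · obtain ⟨i, hi'⟩ : ∃ i, s.reg 1 = i + 1 := ⟨s.reg 1 - 1, by omega⟩
      rw [hi'] at hI
      simp only [hi', Nat.add_sub_cancel] at *
      refine ⟨by omega, by omega, by omega, fun hz' => ?_, fun hz' => ?_⟩
      · simp
        refine ⟨by omega, by omega, h51, fun x => ?_, hI.splice hG.toRooted hz hz'⟩
        rw [Function.update_apply, Function.update_apply]
        split_ifs
        · omega
        · exact h3'
        · exact h3 x
      · simp
        exact ⟨h51, h3, hI.skip hG.toRooted hz hz'⟩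
  · rintro s ⟨-, -, -, -, -, -, hI⟩
    have := card_unmarked_le (n := n) (rem := s.arr 5)
    have := hI.le
    omega
  · rintro s ⟨i0, -, i4, -, -, -, hI⟩ hb
    simp only [Test.Holds, i4, not_not] at hb
    rw [hb] at hI
    exact ⟨i0, hI.eq⟩
  · have := hG.one_lt
    simp [cost]
    omega

end RAM

namespace RAM

open Cayley

theorem table_zero {n : ℕ} (f : Fn n) : table f 0 = 0 :=
  table_of_notMem fun h => absurd h.1 (by omega)

/-- The program that computes `Θ`. -/
def thetaProgram : Program :=
  loadTable ;; countEdges ;; peel ;; mergeCycles ;; emitTable 3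

/-- The constant is the sum 10 + 9 + 30 + 30 + 13 of the bounds of the five phases; the word bound
needed is only `n + 1`. -/
theorem outputs_thetaProgram {n : ℕ} (hn : 2 ≤ n) (f : Fn n) {L : List (Vertex n × Vertex n)}
    (hL : IsEdgeList (graph f) L) : Outputs thetaProgram (92 * n) (92 * n) n L (theta f) := by
  have hW : n + 1 ≤ 92 * n := by omega
  have hlink := linked_rootedTable (f := f) hn
  have hms := hlink.isMaxList_maximaBelow
  obtain ⟨q, hq, -⟩ := hlink.relink hms
  rw [graph_eq_graphOf] at hL
  have hrun : Run (92 * n) thetaProgram (input n L) (10 * n + (9 * n + (30 * n + (30 * n + 13 * n))))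
      (fun s => ∃ L', IsTable (theta f) L' ∧ s.Stores n L') := by
    refine (run_loadTable (by omega) hW table_le (fun x hx => ?_) hL).seq ?_
    · by_contra hc
      exact hx (table_of_notMem fun hh => hc ⟨hh.1.le, hh.2.le⟩)
    rintro s ⟨h0, h2, ha⟩
    refine (run_countEdges hn hW h0 h2 ha).seq ?_
    rintro s ⟨h0, h2, h3, h5, h4⟩
    refine (run_peel hn hW hlink.toRooted h0 h2 h3 h5 h4).seq ?_
    rintro s ⟨h0, h2, h3, h50, h51, h5⟩
    refine (run_mergeCycles hW hlink h0 h2 h3 h50 h51 h5).seq ?_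
    rintro s ⟨h0, h3⟩
    rw [theta_eq_graphOf hn hms]
    exact run_emitTable (by omega) hW (by omega) hq.zero hq.le h0 h3
  obtain ⟨t, ht, s, he, hs⟩ := hrun
  exact ⟨t, by omega, s, he, hs⟩

/-! ### The program for the inverse -/

/-- Write the path from `n` to the root to array `3`. -/
def walkPath : Program :=
  (.assign 1 (.const 0) ;; .assign 2 (.copy 0) ;; .assign 3 (.const 1) ;; .store 3 1 2) ;;
  .while (.ne 2 3) (.assign 2 (.load 2 2) ;; .assign 1 (.add 1 3) ;; .store 3 1 2)

theorem run_walkPath {n W K : ℕ} (hn : 2 ≤ n) (hW : n + 1 ≤ W) {T : ℕ → ℕ} (hT : Rooted n T)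
    (hK : PathLength n T K) {s : State} (hs : s.reg 0 = n) (h2 : s.arr 2 = T) :
    Run W walkPath s (7 * n)
      (fun s => s.reg 0 = n ∧ s.reg 1 = K ∧ s.arr 2 = T ∧ ∀ i ≤ K, s.arr 3 i = T^[i] n) := by
  have hKn := hK.length_le hT
  let I : State → Prop := fun s => s.reg 0 = n ∧ s.reg 3 = 1 ∧ s.arr 2 = T ∧
    s.reg 2 = T^[s.reg 1] n ∧ s.reg 1 ≤ K ∧ ∀ i ≤ s.reg 1, s.arr 3 i = T^[i] n
  refine Run.seq_while I (fun s => K - s.reg 1) n ?_ ?_ ?_ ?_ ?_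
  · simp [wp, Op.eval, I, hs, h2]
    omega
  · rintro s ⟨i0, i3, a2, i2, i1, h3⟩ hb
    simp only [Test.Holds, i3, i2] at hb
    have hlt : s.reg 1 < K := lt_of_le_of_ne i1 fun h => hb (h ▸ hK.eq)
    have hle := hT.le (T^[s.reg 1] n)
    simp [wp, Op.eval, I, i0, i3, a2, i2]
    refine ⟨by omega, by omega, ⟨(Function.iterate_succ_apply' ..).symm, by omega,
      fun i hi => ?_⟩, by omega⟩
    rw [Function.update_apply]
    split_ifs with h
    · rw [h, Function.iterate_succ_apply']
    · exact h3 i (by omega)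
  · rintro s -
    omega
  · rintro s ⟨i0, i3, a2, i2, i1, h3⟩ hb
    simp only [Test.Holds, i3, i2, not_not] at hb
    obtain rfl : s.reg 1 = K := le_antisymm i1 (hK.le _ hb)
    exact ⟨i0, rfl, a2, h3⟩
  · simp [cost]
    omega

/-- Split the merged cycles off the path in array `3`, and delete the edge of `n`. -/
def splitCycles : Program :=
  ((.assign 3 (.const 1) ;; .assign 4 (.const 0) ;; .assign 1 (.sub 1 3) ;;
      .assign 7 (.load 3 1)) ;;
    .while (.ne 1 4)
      (.assign 1 (.sub 1 3) ;; .assign 2 (.load 3 1) ;;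
        .ite (.lt 7 2)
          (.assign 5 (.load 2 2) ;; .store 2 7 5 ;; .store 2 2 3 ;; .assign 7 (.copy 2))
          .skip)) ;;
  .assign 4 (.const 0) ;; .store 2 0 4

theorem run_splitCycles {n W K : ℕ} (hn : 2 ≤ n) (hW : n + 1 ≤ W) {T : ℕ → ℕ} (hT : Rooted n T)
    (hc : ∀ x, ¬ Cyc T x) (hK : PathLength n T K) {s : State} (hs : s.reg 0 = n)
    (hs1 : s.reg 1 = K) (h2 : s.arr 2 = T) (h3 : ∀ i ≤ K, s.arr 3 i = T^[i] n) :
    Run W splitCycles s (12 * n + 2)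
      (fun s => s.reg 0 = n ∧ ∃ p G, BackInv n T K 0 p G ∧ s.arr 2 = Function.update G n 0) := by
  have hKn := hK.length_le hT
  have hle : ∀ i, T^[i] n ≤ n := by
    rintro (_ | i)
    · exact le_rfl
    · rw [Function.iterate_succ_apply']
      exact hT.le _
  let I : State → Prop := fun s => s.reg 0 = n ∧ s.reg 3 = 1 ∧ s.reg 4 = 0 ∧ s.reg 1 < K ∧
    (∀ i ≤ K, s.arr 3 i = T^[i] n) ∧ BackInv n T K (s.reg 1) (s.reg 7) (s.arr 2)
  have hKpos := hK.pos hn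
  -- The walk starts at path vertex number `K - 1`, the predecessor of the root, and `K ≤ n`.
  refine (Run.seq_while (c := 12 * n) (Q := fun s => s.reg 0 = n ∧ ∃ p, BackInv n T K 0 p (s.arr 2))
    I (fun s => s.reg 1) (n - 1) ?_ ?_ ?_ ?_ ?_).seq (d := 2) ?_
  · have := hle (K - 1)
    simp [wp, Op.eval, I, hs, hs1, h2, h3]
    exact ⟨by omega, by omega, by omega, by omega, h3, .start hn hT hc hK⟩
  · rintro s ⟨i0, i3, i4, i1, h3, hI⟩ hb
    simp only [Test.Holds, i4] at hb
    obtain ⟨j, hj⟩ : ∃ j, s.reg 1 = j + 1 := ⟨s.reg 1 - 1, by omega⟩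
    rw [hj] at hI i1
    have hG := hI.linked.le (T^[j] n)
    have hjn := hle j
    have hP := h3 j (by omega)
    simp only [wp, Op.eval, Test.Holds, I, State.setReg_reg, State.setReg_arr, State.setArr_reg,
      State.setArr_arr, i0, i3, i4, hj, hP, reduceIte, Nat.reduceEqDiff, Nat.add_sub_cancel]
    refine ⟨by omega, by omega, fun hz => ?_, fun hz => ?_⟩
    · simp
      exact ⟨by omega, by omega, by omega, h3, hI.splice hK hz⟩
    · simp
      exact ⟨by omega, h3, hI.skip (by omega)⟩
  · rintro s ⟨-, -, -, i1, -⟩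
    omega
  · rintro s ⟨i0, -, i4, -, -, hI⟩ hb
    simp only [Test.Holds, i4, not_not] at hb
    rw [hb] at hI
    exact ⟨i0, _, hI⟩
  · simp [cost]
    omega
  · rintro s ⟨h0, p, hI⟩
    refine Run.of_wp ?_
    simp [wp, Op.eval, h0]
    exact ⟨p, _, hI, rfl⟩

/-- The program that computes the inverse of `Θ`. -/
def thetaInvProgram : Program :=
  loadTable ;; walkPath ;; splitCycles ;; emitTable 2

/-- The preimage `f` is read off from the final state of the backward walk. The four phases take at
most `42 * n + 2` steps, and `2 ≤ n` absorbs the remainder. -/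
theorem outputs_thetaInvProgram {n : ℕ} (hn : 2 ≤ n) {T : Digraph (Vertex n)} (hT : T ∈ Trees n)
    {L : List (Vertex n × Vertex n)} (hL : IsEdgeList T L) :
    ∃ f : Fn n, theta f = T ∧ Outputs thetaInvProgram (43 * n) (43 * n) n L (graph f) := by
  have hW : n + 1 ≤ 43 * n := by omega
  obtain ⟨A, rfl, hA, hc⟩ := exists_graphOf_of_mem_Trees hT
  obtain ⟨K, hK⟩ := PathLength.exists (hA.leads_one hc (by omega) le_rfl)
  have hrun : Run (43 * n) thetaInvProgram (input n L) (10 * n + (7 * n + (12 * n + 2 + 13 * n)))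
      (fun s => ∃ f : Fn n, theta f = graphOf n A ∧
        ∃ L', IsTable (graph f) L' ∧ s.Stores n L') := by
    refine (run_loadTable (by omega) hW hA.le (fun x hx => ?_) hL).seq ?_
    · by_contra hcon
      exact hx (hA.out x fun hh => hcon ⟨hh.1.le, hh.2⟩)
    rintro s ⟨h0, h2, -⟩
    refine (run_walkPath hn hW hA hK h0 h2).seq ?_
    rintro s ⟨h0, h1, h2, h3⟩
    refine (run_splitCycles hn hW hA hc hK h0 h1 h2 h3).seq ?_
    rintro s ⟨h0, p, G, hI, h2⟩
    obtain ⟨f, hf, hfT⟩ := hI.exists_fn hn hc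
    rw [← hf] at h2
    refine (run_emitTable (by omega) hW le_rfl (table_zero f) table_le h0 h2).mono le_rfl
      fun s hs => ⟨f, hfT, ?_⟩
    rw [graph_eq_graphOf]
    exact hs
  obtain ⟨t, ht, s, he, f, hf, hs⟩ := hrun
  exact ⟨f, hf, t, by omega, s, he, hs⟩

end RAM

/-! ### Bijectivity -/

namespace Cayley

/-- Every digraph on `[n]` has a list of its edges. -/
theorem exists_isEdgeList {n : ℕ} (G : Digraph (Vertex n)) : ∃ L, IsEdgeList G L := by
  classical
  exact ⟨(Finset.univ.filter fun e : Vertex n × Vertex n => G.Adj e.1 e.2).toList,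
    Finset.nodup_toList _, fun i j => by simp⟩

theorem theta_bijOn {n : ℕ} (hn : 2 ≤ n) : Set.BijOn (theta (n := n)) Set.univ (Trees n) := by
  refine ⟨fun f _ => theta_mem_Trees hn f, (theta_injective hn).injOn, fun T hT => ?_⟩
  -- Surjectivity comes from running the inverse program on some edge list of `T`.
  obtain ⟨L, hL⟩ := exists_isEdgeList T
  obtain ⟨f, hf, -⟩ := RAM.outputs_thetaInvProgram hn hT hL
  exact ⟨f, Set.mem_univ f, hf⟩

end Cayley

theorem mainTheorem4 :
    (∀ n : ℕ, 2 ≤ n → Set.BijOn (Cayley.theta (n := n)) Set.univ (Cayley.Trees n)) ∧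
    (∃ (p : RAM.Program) (C : ℕ), ∀ n : ℕ, 2 ≤ n → ∀ f : Cayley.Fn n,
      ∀ L : List (Cayley.Vertex n × Cayley.Vertex n), Cayley.IsEdgeList (Cayley.graph f) L →
        RAM.Outputs p (C * n) (C * n) n L (Cayley.theta f)) ∧
    (∃ (p : RAM.Program) (C : ℕ), ∀ n : ℕ, 2 ≤ n → ∀ T ∈ Cayley.Trees n,
      ∀ L : List (Cayley.Vertex n × Cayley.Vertex n), Cayley.IsEdgeList T L →
        ∃ f : Cayley.Fn n, Cayley.theta f = T ∧
          RAM.Outputs p (C * n) (C * n) n L (Cayley.graph f)) :=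
  ⟨fun _ hn => Cayley.theta_bijOn hn,
    ⟨RAM.thetaProgram, 92, fun _ hn f _ hL => RAM.outputs_thetaProgram hn f hL⟩,
    ⟨RAM.thetaInvProgram, 43, fun _ hn _ hT _ hL => RAM.outputs_thetaInvProgram hn hT hL⟩⟩
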